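/- **Setting.** Let $0<\alpha\le 1/2$, $p\ge 1$, and let $(X,Y)\in\mathbb R^p\times\mathbb R$ satisfy the joint linear model $Q_\alpha(Y\mid X)=X^{\mathsf T}\beta^*$ and $\mathrm{ES}_\alpha(Y\mid X):=\mathbb E\{Y\mid Y\le Q_\alpha(Y\mid X),X\}=X^{\mathsf T}\theta^*$ almost surely, where $Q_\alpha(Y\mid X)$ is the conditional $\alpha$-quantile. Put $\varepsilon=Y-X^{\mathsf T}\beta^*$ and $\Sigma=\mathbb E(XX^{\mathsf T})$. Assume that, for constants $\bar f$, $\bar\sigma>0$, $\upsilon_1\ge1$: (i) almost surely over $X$, the conditional CDF $F_{\varepsilon|X}$ is continuously differentiable, $|F_{\varepsilon|X}(s)-F_{\varepsilon|X}(0)|\le \bar f|s|$ for all $s\in\mathbb R$, and $\mathrm{var}(\varepsilon\wedge 0\mid X)\le\bar\sigma^2$; (ii) $\Sigma$ is positive definite and $W=\Sigma^{-1/2}X$ satisfies $\mathbb P(|u^{\mathsf T}W|\ge \upsilon_1 s)\le 2e^{-s^2/2}$ for all $s\ge 0$ and all unit vectors $u\in\mathbb R^p$. Let $(X_1,Y_1),\dots,(X_n,Y_n)$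 be i.i.d. copies of $(X,Y)$. With $\rho_\alpha(u)=\{\alpha-\mathbb 1(u<0)\}u$, the quantile regression estimators are $$\hat\beta\in\arg\min_{\beta\in\mathbb R^p}\ \frac1n\sum_{i=1}^n\rho_\alpha(Y_i-X_i^{\mathsf T}\beta).$$ For $\tau>0$ let $\ell_\tau(u)=u^2/2$ if $|u|\le\tau$ and $\ell_\tau(u)=\tau|u|-\tau^2/2$ otherwise, and $\psi_\tau(u)=\ell_\tau'(u)=\mathrm{sign}(u)\min(|u|,\tau)$. Put $S_i(\beta,\theta)=\alpha X_i^{\mathsf T}\theta-\mathbb 1(Y_i\le X_i^{\mathsf T}\beta)Y_i+\{\mathbb 1(Y_i\le X_i^{\mathsf T}\beta)-\alpha\}X_i^{\mathsf T}\beta$. The two-step robust ES estimators are $$\hat\theta_\tau\in\arg\min_{\theta\in\mathbb R^p}\ \frac1n\sum_{i=1}^n\ell_\tau\big(S_i(\hat\beta,\theta)\big).$$ Write $\|v\|_\Sigma=\|\Sigma^{1/2}v\|_2$, $W_i=\Sigma^{-1/2}X_i$ and $\omega_i=(Y_i-X_i^{\mathsf T}\beta^*)\mathbb 1(Y_i\le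 X_i^{\mathsf T}\beta^*)+\alpha X_i^{\mathsf T}(\beta^*-\theta^*)$. **Theorem.** For all $\upsilon_1\ge1$ and $a,b,c_1,c_2>0$ there are constants $C,C_0>0$, depending only on $(\upsilon_1,a,b,c_1,c_2)$, such that the following holds in the above setting. Let $t>0$, let $r_0>0$ satisfy $r_0\le a\bar\sigma$ and $\bar f r_0^2\le b\,\bar\sigma\sqrt{(p+t)/n}$, let $c_1\bar\sigma\sqrt{n/(p+t)}\le\tau\le c_2\bar\sigma\sqrt{n/(p+t)}$, and let $n\ge C_0(p+t)$. Then there is an event $E$ with $\mathbb P(E)\ge 1-6e^{-t}$ such that on $E$, for every choice of the minimizers $\hat\beta$ and $\hat\theta_\tau$, if $\|\hat\beta-\beta^*\|_\Sigma\le r_0$, then $$\Big\|\alpha\Sigma^{1/2}(\hat\theta_\tau-\theta^*)-\frac1n\sum_{i=1}^n\psi_\tau(\omega_i)W_i\Big\|_2\le C\Big\{\bar\sigma\,\frac{p+t}{n}+\bar f r_0^2+r_0\sqrt{\frac{p\log n+t}{n}}\Big\}.$$ -/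

import Mathlib

open MeasureTheory ProbabilityTheory Set
open scoped MatrixOrder RealInnerProductSpace

noncomputable section

/-- Covariates and regression coefficients live in Euclidean space `ℝ^p`. -/
abbrev Vec (p : ℕ) : Type := EuclideanSpace ℝ (Fin p)

/-! ### The population model

Here `P` is the joint law of `(X, Y)` on `ℝ^p × ℝ`; `P.fst` is the law of `X` and `P.condKernel x` is
the regular conditional distribution of `Y` given `X = x`. -/

/-- Conditional `α`-quantile of `Y` given `X = x`: `inf {y : F_{Y|X=x}(y) ≥ α}`. -/
def condQuantile {p : ℕ} (P : Measure (Vec p × ℝ)) [IsFiniteMeasure P] (α : ℝ) (x : Vec p) : ℝ :=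
  sInf {y : ℝ | α ≤ (P.condKernel x).real (Iic y)}

/-- Conditional expected shortfall `E(Y | Y ≤ Q_α(Y | X = x), X = x)`. -/
def condES {p : ℕ} (P : Measure (Vec p × ℝ)) [IsFiniteMeasure P] (α : ℝ) (x : Vec p) : ℝ :=
  ⨍ y in Iic (condQuantile P α x), y ∂(P.condKernel x)

/-- The joint linear model: almost surely over `X`, `Q_α(Y | X) = Xᵀβ` and `ES_α(Y | X)` exists and
equals `Xᵀθ`. -/
def JointModel {p : ℕ} (P : Measure (Vec p × ℝ)) [IsFiniteMeasure P] (α : ℝ) (β θ : Vec p) : Prop :=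
  ∀ᵐ x ∂P.fst,
    condQuantile P α x = ⟪x, β⟫ ∧
    IntegrableOn (fun y : ℝ => y) (Iic (condQuantile P α x)) (P.condKernel x) ∧
    condES P α x = ⟪x, θ⟫

/-- Conditional CDF `F_{ε | X = x}(s)` of the quantile residual `ε = Y - Xᵀβ`. -/
def residCDF {p : ℕ} (P : Measure (Vec p × ℝ)) [IsFiniteMeasure P] (β x : Vec p) (s : ℝ) : ℝ :=
  (P.condKernel x).real {y : ℝ | y - ⟪x, β⟫ ≤ s}

/-- Condition on the conditional law of `ε = Y - Xᵀβ` given `X`, almost surely over `X`: the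
conditional CDF is continuously differentiable with `|F(s) - F(0)| ≤ fbar |s|`, and the negative part
`ε ∧ 0` has conditional variance at most `σbar²`. -/
def ResidualCondition {p : ℕ} (P : Measure (Vec p × ℝ)) [IsFiniteMeasure P] (β : Vec p)
    (fbar σbar : ℝ) : Prop :=
  ∀ᵐ x ∂P.fst,
    ContDiff ℝ 1 (residCDF P β x) ∧
    (∀ s : ℝ, |residCDF P β x s - residCDF P β x 0| ≤ fbar * |s|) ∧
    MemLp (fun y : ℝ => min (y - ⟪x, β⟫) 0) 2 (P.condKernel x) ∧
    variance (fun y : ℝ => min (y - ⟪x, β⟫) 0) (P.condKernel x) ≤ σbar ^ 2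

/-- The second moment matrix `Σ = E(X Xᵀ)`. -/
def secondMoment {p : ℕ} (P : Measure (Vec p × ℝ)) : Matrix (Fin p) (Fin p) ℝ :=
  Matrix.of fun i j => ∫ x, x i * x j ∂P.fst

/-- `A^{1/2} v`, where `A^{1/2}` is the positive semidefinite square root. -/
def sqrtMul {p : ℕ} (A : Matrix (Fin p) (Fin p) ℝ) (v : Vec p) : Vec p :=
  Matrix.toEuclideanLin (CFC.sqrt A) v

/-- `A^{-1/2} v`, for positive definite `A`. -/
def invSqrtMul {p : ℕ} (A : Matrix (Fin p) (Fin p) ℝ) (v : Vec p) : Vec p :=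
  Matrix.toEuclideanLin (CFC.sqrt A)⁻¹ v

/-- The norm `‖v‖_A = ‖A^{1/2} v‖₂`. -/
def matNorm {p : ℕ} (A : Matrix (Fin p) (Fin p) ℝ) (v : Vec p) : ℝ := ‖sqrtMul A v‖

/-- Sub-Gaussian covariates: `Σ` is positive definite and `W = Σ^{-1/2} X` satisfies
`P(|uᵀW| ≥ υ s) ≤ 2 exp(-s²/2)` for all `s ≥ 0` and all unit vectors `u`. -/
def SubGaussianCovariate {p : ℕ} (P : Measure (Vec p × ℝ)) (υ : ℝ) : Prop :=
  (secondMoment P).PosDef ∧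
  ∀ u : Vec p, ‖u‖ = 1 → ∀ s : ℝ, 0 ≤ s →
    P.fst.real {x | υ * s ≤ |⟪u, invSqrtMul (secondMoment P) x⟫|} ≤ 2 * Real.exp (-s ^ 2 / 2)

/-! ### The two-step robust estimator -/

/-- The indicator `1(y ≤ q)`. -/
def leInd (y q : ℝ) : ℝ := (Iic q).indicator (fun _ => 1) y

/-- Check function `ρ_α(u) = {α - 1(u < 0)} u`. -/
def checkLoss (α u : ℝ) : ℝ := (α - (Iio (0 : ℝ)).indicator (fun _ => 1) u) * u

/-- Huber loss. -/
def huberLoss (τ u : ℝ) : ℝ := if |u| ≤ τ then u ^ 2 / 2 else τ * |u| - τ ^ 2 / 2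

/-- Huber score `ψ_τ(u) = sign(u) min(|u|, τ)`, the derivative of the Huber loss. -/
def huberScore (τ u : ℝ) : ℝ := max (-τ) (min u τ)

/-- The orthogonal score
`S(β, θ; y, x) = α xᵀθ - 1(y ≤ xᵀβ) y + {1(y ≤ xᵀβ) - α} xᵀβ`. -/
def orthScore {p : ℕ} (α : ℝ) (β θ x : Vec p) (y : ℝ) : ℝ :=
  α * ⟪x, θ⟫ - leInd y ⟪x, β⟫ * y + (leInd y ⟪x, β⟫ - α) * ⟪x, β⟫

/-- `b` is a quantile regression estimator: a global minimizer of the empirical check loss. -/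
def IsQREstimator {n p : ℕ} (α : ℝ) (x : Fin n → Vec p) (y : Fin n → ℝ) (b : Vec p) : Prop :=
  IsMinOn (fun β : Vec p => (1 / (n : ℝ)) * ∑ i, checkLoss α (y i - ⟪x i, β⟫)) univ b

/-- `h` is a robust (Huberized) ES estimator with first-stage estimate `b`: a global minimizer of
`θ ↦ n⁻¹ ∑ ℓ_τ(S_i(b, θ))`. -/
def IsRobustES {n p : ℕ} (α τ : ℝ) (x : Fin n → Vec p) (y : Fin n → ℝ) (b h : Vec p) : Prop :=
  IsMinOn (fun θ : Vec p => (1 / (n : ℝ)) * ∑ i, huberLoss τ (orthScore α b θ (x i) (y i))) univ h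

/-- The ES residual `ω = (y - xᵀβ) 1(y ≤ xᵀβ) + α xᵀ(β - θ)`. -/
def esResid {p : ℕ} (α : ℝ) (β θ x : Vec p) (y : ℝ) : ℝ :=
  (y - ⟪x, β⟫) * leInd y ⟪x, β⟫ + α * ⟪x, β - θ⟫

/-- The Bahadur remainder
`‖α Σ^{1/2}(h - θ) - n⁻¹ ∑ ψ_τ(ω_i) W_i‖₂` with `W_i = Σ^{-1/2} X_i`. -/
def bahadurRemainder {n p : ℕ} (S : Matrix (Fin p) (Fin p) ℝ) (α τ : ℝ) (β θ : Vec p)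
    (x : Fin n → Vec p) (y : Fin n → ℝ) (h : Vec p) : ℝ :=
  ‖α • sqrtMul S (h - θ) -
    (1 / (n : ℝ)) • ∑ i, huberScore τ (esResid α β θ (x i) (y i)) • invSqrtMul S (x i)‖

end

/-!
Put `w_i = Σ^{-1/2} X_i`, `δ = Σ^{1/2}(β̂ - β*)` and `η = α Σ^{1/2}(θ - θ*)`. In these coordinates the
orthogonal score is `w_iᵀη - (ω_i + g_i(δ))`, where `g_i(δ) = min(ε_i - w_iᵀδ, 0) - min(ε_i, 0) + α w_iᵀδ`
(`orthScore_eq`). The first-stage error thus enters only through `g_i`, which is `1`-Lipschitz in `w_iᵀδ`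
and has conditional mean of order `f̄ (w_iᵀδ)²`: the quantile condition cancels the linear term, which is
Neyman orthogonality (`abs_integral_hingeIncr_le`).

Writing `ψ_τ(u) = u - (soft threshold of u)`, the average of
`{ψ_τ(ω_i + g_i(δ) - w_iᵀη) - ψ_τ(ω_i)} w_i + η` splits into

* `(I - Σ̂) η`, with `Σ̂` the Gram matrix of the `w_i` (`measure_gram_le`);
* the average of `g_i(δ) w_i` (`measure_firstStage_le`);
* a soft-threshold increment, which only lives on sample points with `|ω_i| > τ / 2`
  (`measure_noise_truncation_le`) or with a large value of a linear functional of `w_i`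
  (`measure_tail_truncation_le`).

All of these are bounded uniformly over `‖δ‖ ≤ r₀` and `‖η‖ ≤ r₁` by Chernoff bounds over finite nets of
the unit ball (`measure_exists_sum_ge_le`, `exists_finset_net`). Together with the bound on the score
`n⁻¹ ∑ ψ_τ(ω_i) w_i` (`measure_score_le`), convexity of the Huber loss first localizes the minimizer in
the ball of radius `r₁` and then identifies it with the score up to the linearization error
(`huber_bahadur`). The five events have total failure probability at most `5 e^{-t}`. The
bound is uniform over the ball `‖δ‖ ≤ r₀`, so no property of the first-stage estimator besides its rate
plays a role.
-/

/-! ### The Huber score and its soft-threshold residual -/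

lemma abs_huberScore_le {τ : ℝ} (hτ : 0 ≤ τ) (u : ℝ) : |huberScore τ u| ≤ τ := by
  unfold huberScore
  rw [abs_le]
  exact ⟨le_max_left _ _, max_le (by linarith) (min_le_right _ _)⟩

lemma abs_huberScore_le_abs {τ : ℝ} (hτ : 0 ≤ τ) (u : ℝ) : |huberScore τ u| ≤ |u| := by
  unfold huberScore
  rcases abs_cases u with h | h <;> rw [abs_le] <;> constructor <;> grind

lemma huberScore_neg (τ : ℝ) (hτ : 0 ≤ τ) (u : ℝ) : huberScore τ (-u) = -huberScore τ u := by
  unfold huberScore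
  grind

lemma huberScore_monotone (τ : ℝ) : Monotone (huberScore τ) := fun _ _ h =>
  max_le_max le_rfl (min_le_min h le_rfl)

lemma measurable_huberScore (τ : ℝ) : Measurable (huberScore τ) := by
  unfold huberScore
  fun_prop

lemma abs_huberScore_sub_self_le {τ : ℝ} (hτ : 0 < τ) (u : ℝ) :
    |huberScore τ u - u| ≤ u ^ 2 / τ := by
  rw [le_div_iff₀ hτ]
  unfold huberScore
  rcases le_total u (-τ) with h | h
  · rw [min_eq_left (by linarith), max_eq_left h, abs_of_nonneg (by linarith)]
    nlinarith
  · rcases le_total u τ with h' | h'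
    · rw [min_eq_left h', max_eq_right h]
      simp [sq_nonneg]
    · rw [min_eq_right h', max_eq_right (by linarith), abs_of_nonpos (by linarith)]
      nlinarith

/-- The residual `u - ψ_τ(u)` of the Huber score (soft thresholding) is `1`-Lipschitz. -/
lemma abs_sub_huberScore_sub_le {τ : ℝ} (hτ : 0 ≤ τ) (u v : ℝ) :
    |(u - huberScore τ u) - (v - huberScore τ v)| ≤ |u - v| := by
  unfold huberScore
  rcases abs_cases (u - v) with h | h <;> rw [abs_le] <;> constructor <;> grind

lemma huberScore_eq_self {τ u : ℝ} (hu : |u| ≤ τ) : huberScore τ u = u := by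
  have := abs_le.1 hu
  unfold huberScore
  rw [min_eq_left this.2, max_eq_right this.1]

/-- The Huber loss has a `1`-Lipschitz derivative, which is the Huber score. -/
lemma huberLoss_add_le {τ : ℝ} (hτ : 0 < τ) (u s : ℝ) :
    huberLoss τ (u + s) ≤ huberLoss τ u + huberScore τ u * s + s ^ 2 / 2 := by
  -- The Huber loss is the minimum over `v` of `(u - v)² / 2 + τ |v|`, attained at `v = u - ψ_τ(u)`.
  have key : ∀ x v : ℝ, huberLoss τ x ≤ (x - v) ^ 2 / 2 + τ * |v| := by
    intro x v
    unfold huberLoss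
    split_ifs with h
    · rcases abs_cases v with h1 | h1 <;> rcases abs_cases x with h2 | h2 <;> nlinarith
    · rcases abs_cases v with h1 | h1 <;> rcases abs_cases x with h2 | h2 <;>
        nlinarith [sq_nonneg (x - v - τ), sq_nonneg (x - v + τ)]
  have att : (u - (u - huberScore τ u)) ^ 2 / 2 + τ * |u - huberScore τ u| = huberLoss τ u := by
    unfold huberLoss
    split_ifs with h
    · rw [huberScore_eq_self h]
      simp
    · unfold huberScore
      rw [not_le, lt_abs] at h
      rcases h with h | h
      · rw [min_eq_right h.le, max_eq_right (by linarith), abs_of_pos (by linarith : 0 < u - τ),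
          abs_of_pos (by linarith : 0 < u)]
        ring
      · rw [min_eq_left (by linarith), max_eq_left (by linarith),
          abs_of_neg (by linarith : u - -τ < 0), abs_of_neg (by linarith : u < 0)]
        ring
  have := key (u + s) (u - huberScore τ u)
  nlinarith [att]

/-- `y² 1(|y| > T)`. -/
noncomputable def sqTail (T y : ℝ) : ℝ := if T < |y| then y ^ 2 else 0

/-- The indicator `1(|y| > T)`. -/
noncomputable def absInd (T y : ℝ) : ℝ := if T < |y| then 1 else 0

lemma sqTail_nonneg (T y : ℝ) : 0 ≤ sqTail T y := by
  unfold sqTail; split_ifs <;> positivity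

lemma absInd_nonneg (T y : ℝ) : 0 ≤ absInd T y := by
  unfold absInd; split_ifs <;> norm_num

lemma abs_mul_abs_le_sqTail_add (T a b : ℝ) (h : T < |a|) : |a| * |b| ≤ sqTail T a + sqTail T b := by
  rcases le_total |b| |a| with hb | hb
  · have : |a| * |b| ≤ sqTail T a := by
      unfold sqTail
      rw [if_pos h, ← sq_abs a]
      nlinarith [abs_nonneg a]
    linarith [sqTail_nonneg T b]
  · have : |a| * |b| ≤ sqTail T b := by
      unfold sqTail
      rw [if_pos (by linarith), ← sq_abs b]
      nlinarith [abs_nonneg b]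
    linarith [sqTail_nonneg T a]

/-- The soft-threshold residual only moves at sample points whose noise `o` exceeds `τ / 2` or whose
perturbation `g - r₁ B` does. -/
lemma abs_softThreshold_increment_mul_le {τ T r₀ r₁ o g A B x : ℝ} (hτ : 0 < τ) (hr₀ : 0 < r₀)
    (hr₁ : 0 < r₁) (hT : (r₀ + r₁) * T ≤ τ / 2) (hg : |g| ≤ r₀ * |A|) :
    |((o + g - r₁ * B) - huberScore τ (o + g - r₁ * B)) - (o - huberScore τ o)| * |x| ≤
      (r₀ / 2 * A ^ 2 + r₁ / 2 * B ^ 2 + (r₀ + r₁) / 2 * x ^ 2) * absInd (τ / 2) o +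
      (r₀ + r₁) * (sqTail T A + sqTail T B + sqTail T x) := by
  have hlip := abs_sub_huberScore_sub_le hτ.le (o + g - r₁ * B) o
  have hd : |o + g - r₁ * B - o| ≤ r₀ * |A| + r₁ * |B| := by
    have : o + g - r₁ * B - o = g - r₁ * B := by ring
    rw [this]
    calc |g - r₁ * B| ≤ |g| + |r₁ * B| := abs_sub _ _
      _ ≤ r₀ * |A| + r₁ * |B| := by rw [abs_mul, abs_of_pos hr₁]; linarith
  have hs : 0 ≤ sqTail T A + sqTail T B + sqTail T x :=
    add_nonneg (add_nonneg (sqTail_nonneg _ _) (sqTail_nonneg _ _)) (sqTail_nonneg _ _)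
  have hq : 0 ≤ (r₀ / 2 * A ^ 2 + r₁ / 2 * B ^ 2 + (r₀ + r₁) / 2 * x ^ 2) := by positivity
  by_cases ho : τ / 2 < |o|
  · have : absInd (τ / 2) o = 1 := if_pos ho
    rw [this, mul_one]
    have h1 : (r₀ * |A| + r₁ * |B|) * |x| ≤
        r₀ / 2 * A ^ 2 + r₁ / 2 * B ^ 2 + (r₀ + r₁) / 2 * x ^ 2 := by
      rw [← sq_abs A, ← sq_abs B, ← sq_abs x]
      nlinarith [mul_nonneg hr₀.le (sq_nonneg (|A| - |x|)), mul_nonneg hr₁.le (sq_nonneg (|B| - |x|))]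
    have h2 := mul_le_mul_of_nonneg_right (hlip.trans hd) (abs_nonneg x)
    nlinarith
  · rw [show absInd (τ / 2) o = 0 from if_neg ho, mul_zero, zero_add]
    rw [not_lt] at ho
    by_cases hD : τ / 2 < r₀ * |A| + r₁ * |B|
    · have h2 := mul_le_mul_of_nonneg_right (hlip.trans hd) (abs_nonneg x)
      refine h2.trans ?_
      rcases le_total |A| |B| with hAB | hAB
      · have hB : T < |B| := by
          by_contra hc
          nlinarith
        have := abs_mul_abs_le_sqTail_add T B x hB
        have h3 : (r₀ * |A| + r₁ * |B|) * |x| ≤ (r₀ + r₁) * (|B| * |x|) := by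
          have : r₀ * |A| ≤ r₀ * |B| := mul_le_mul_of_nonneg_left hAB hr₀.le
          nlinarith [abs_nonneg x]
        refine h3.trans (mul_le_mul_of_nonneg_left ?_ (by positivity))
        linarith [sqTail_nonneg T A]
      · have hB : T < |A| := by
          by_contra hc
          nlinarith
        have := abs_mul_abs_le_sqTail_add T A x hB
        have h3 : (r₀ * |A| + r₁ * |B|) * |x| ≤ (r₀ + r₁) * (|A| * |x|) := by
          have : r₁ * |B| ≤ r₁ * |A| := mul_le_mul_of_nonneg_left hAB hr₁.le
          nlinarith [abs_nonneg x]
        refine h3.trans (mul_le_mul_of_nonneg_left ?_ (by positivity))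
        linarith [sqTail_nonneg T B]
    · rw [not_lt] at hD
      have e1 : |o + g - r₁ * B| ≤ τ := by
        have : o + g - r₁ * B = o + (o + g - r₁ * B - o) := by ring
        rw [this]
        exact (abs_add_le _ _).trans (by linarith)
      rw [huberScore_eq_self e1, huberScore_eq_self (by linarith : |o| ≤ τ)]
      simp only [sub_self, abs_zero, zero_mul]
      positivity

/-! ### Convex localization of the Huber estimator -/

section Deterministic

variable {E : Type*} [NormedAddCommGroup E] [InnerProductSpace ℝ E]

lemma norm_le_of_inner_le {V : E} {R : ℝ} (hR : 0 ≤ R)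
    (h : ∀ u : E, ‖u‖ ≤ 1 → ⟪V, u⟫ ≤ R) : ‖V‖ ≤ R := by
  rcases eq_or_ne V 0 with rfl | hV
  · simpa using hR
  have hn : 0 < ‖V‖ := norm_pos_iff.2 hV
  have := h (‖V‖⁻¹ • V) (by rw [norm_smul, norm_inv, norm_norm, inv_mul_cancel₀ hn.ne'])
  rw [inner_smul_right, real_inner_self_eq_norm_sq] at this
  field_simp at this
  exact this

lemma eq_zero_of_forall_quadratic_nonneg {b c : ℝ} (h : ∀ s : ℝ, 0 ≤ s * b + s ^ 2 * c) : b = 0 := by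
  by_contra hb
  have hb2 : 0 < b ^ 2 := by positivity
  have h1 := h (-b / (|c| + 1))
  have hc : 0 < |c| + 1 := by positivity
  have : -b / (|c| + 1) * b + (-b / (|c| + 1)) ^ 2 * c
      = -(b ^ 2 * (|c| + 1 - c)) / (|c| + 1) ^ 2 := by
    field_simp
    ring
  rw [this] at h1
  have : -(b ^ 2 * (|c| + 1 - c)) / (|c| + 1) ^ 2 < 0 := by
    apply div_neg_of_neg_of_pos _ (by positivity)
    have : 0 < |c| + 1 - c := by linarith [le_abs_self c]
    have := mul_pos hb2 this
    linarith
  linarith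

/-- First-order condition for a minimizer of the empirical Huber loss. -/
lemma huber_firstOrder {n : ℕ} {τ : ℝ} (hτ : 0 < τ) (w : Fin n → E) (a : Fin n → ℝ) (h : E)
    (hmin : ∀ η : E, ∑ i, huberLoss τ (⟪w i, h⟫ - a i) ≤ ∑ i, huberLoss τ (⟪w i, η⟫ - a i)) (d : E) :
    ∑ i, huberScore τ (a i - ⟪w i, h⟫) * ⟪w i, d⟫ = 0 := by
  have : ∑ i, huberScore τ (⟪w i, h⟫ - a i) * ⟪w i, d⟫ = 0 := by
    apply eq_zero_of_forall_quadratic_nonneg (c := ∑ i, ⟪w i, d⟫ ^ 2 / 2)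
    intro s
    have h1 := hmin (h + s • d)
    have h2 : ∑ i, huberLoss τ (⟪w i, h + s • d⟫ - a i) ≤ ∑ i, huberLoss τ (⟪w i, h⟫ - a i) +
        (s * ∑ i, huberScore τ (⟪w i, h⟫ - a i) * ⟪w i, d⟫ + s ^ 2 * ∑ i, ⟪w i, d⟫ ^ 2 / 2) := by
      rw [Finset.mul_sum, Finset.mul_sum, ← Finset.sum_add_distrib, ← Finset.sum_add_distrib]
      refine Finset.sum_le_sum fun i _ => ?_
      have := huberLoss_add_le hτ (⟪w i, h⟫ - a i) (s * ⟪w i, d⟫)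
      rw [inner_add_right, inner_smul_right,
        show ⟪w i, h⟫ + s * ⟪w i, d⟫ - a i = ⟪w i, h⟫ - a i + s * ⟪w i, d⟫ by ring]
      refine this.trans (le_of_eq ?_)
      ring
    linarith
  rw [← neg_eq_zero, ← Finset.sum_neg_distrib, ← this]
  refine Finset.sum_congr rfl fun i _ => ?_
  rw [← neg_sub (⟪w i, h⟫) (a i), huberScore_neg _ hτ.le]
  ring

/-- Uniform linearization of the Huber estimating function: within the ball of radius `r₁`, the map
`η ↦ n⁻¹ ∑ ψ_τ(ω_i + g_i - w_iᵀη) w_i` is close to `n⁻¹ ∑ ψ_τ(ω_i) w_i - η`. -/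
lemma huber_linearization {n : ℕ} {τ T r₀ r₁ κ₁ κ₂ κ₃ κ₅ : ℝ} (hτ : 0 < τ) (hr₀ : 0 < r₀)
    (hr₁ : 0 < r₁) (hT : (r₀ + r₁) * T ≤ τ / 2) (hκ₁ : 0 ≤ κ₁)
    (w : Fin n → E) (o g : Fin n → ℝ) (δ η : E) (hδ : ‖δ‖ ≤ r₀) (hη : ‖η‖ ≤ r₁)
    (h₁ : ∀ u v : E, |(1 / n : ℝ) * ∑ i, ⟪w i, u⟫ * ⟪w i, v⟫ - ⟪u, v⟫| ≤ κ₁ * ‖u‖ * ‖v‖)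
    (h₂ : ∀ v : E, ‖v‖ ≤ 1 → (1 / n : ℝ) * ∑ i, ⟪w i, v⟫ ^ 2 * absInd (τ / 2) (o i) ≤ κ₂)
    (h₃ : ∀ v : E, ‖v‖ ≤ 1 → (1 / n : ℝ) * ∑ i, sqTail T ⟪w i, v⟫ ≤ κ₃)
    (hg : ∀ i, |g i| ≤ |⟪w i, δ⟫|)
    (h₅ : ∀ u : E, ‖u‖ ≤ 1 → (1 / n : ℝ) * ∑ i, g i * ⟪w i, u⟫ ≤ κ₅) (u : E) (hu : ‖u‖ ≤ 1) :
    (1 / n : ℝ) * ∑ i, (huberScore τ (o i + g i - ⟪w i, η⟫) - huberScore τ (o i)) * ⟪w i, u⟫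
      + ⟪η, u⟫ ≤ κ₁ * r₁ + κ₅ + (κ₂ + 3 * κ₃) * (r₀ + r₁) := by
  set A : E := r₀⁻¹ • δ
  set B : E := r₁⁻¹ • η
  have hA : ‖A‖ ≤ 1 := by
    rw [norm_smul, norm_inv, Real.norm_of_nonneg hr₀.le]
    field_simp
    exact hδ
  have hB : ‖B‖ ≤ 1 := by
    rw [norm_smul, norm_inv, Real.norm_of_nonneg hr₁.le]
    field_simp
    exact hη
  have eA : ∀ i, ⟪w i, δ⟫ = r₀ * ⟪w i, A⟫ := by
    intro i
    simp only [A, inner_smul_right]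
    field_simp
  have eB : ∀ i, ⟪w i, η⟫ = r₁ * ⟪w i, B⟫ := by
    intro i
    simp only [B, inner_smul_right]
    field_simp
  have hn : (0 : ℝ) ≤ 1 / n := by positivity
  have hpt : ∀ i, (huberScore τ (o i + g i - ⟪w i, η⟫) - huberScore τ (o i)) * ⟪w i, u⟫ ≤
      g i * ⟪w i, u⟫ - ⟪w i, η⟫ * ⟪w i, u⟫ + (r₀ / 2 * (⟪w i, A⟫ ^ 2 * absInd (τ / 2) (o i))
        + r₁ / 2 * (⟪w i, B⟫ ^ 2 * absInd (τ / 2) (o i))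
        + (r₀ + r₁) / 2 * (⟪w i, u⟫ ^ 2 * absInd (τ / 2) (o i))
        + (r₀ + r₁) * (sqTail T ⟪w i, A⟫ + sqTail T ⟪w i, B⟫ + sqTail T ⟪w i, u⟫)) := by
    intro i
    have hgi : |g i| ≤ r₀ * |⟪w i, A⟫| := by
      have := hg i
      rwa [eA i, abs_mul, abs_of_pos hr₀] at this
    have := abs_softThreshold_increment_mul_le (o := o i) (B := ⟪w i, B⟫) (x := ⟪w i, u⟫)
      hτ hr₀ hr₁ hT hgi
    rw [eB i]
    set S := huberScore τ (o i + g i - r₁ * ⟪w i, B⟫)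
    set S' := huberScore τ (o i)
    have h4 : (S - S') * ⟪w i, u⟫ = g i * ⟪w i, u⟫ - r₁ * ⟪w i, B⟫ * ⟪w i, u⟫
      + -((o i + g i - r₁ * ⟪w i, B⟫ - S - (o i - S')) * ⟪w i, u⟫) := by ring
    have h5 := neg_le_abs ((o i + g i - r₁ * ⟪w i, B⟫ - S - (o i - S')) * ⟪w i, u⟫)
    rw [abs_mul] at h5
    rw [h4]
    have h6 := h5.trans this
    linarith
  have hsum := mul_le_mul_of_nonneg_left (Finset.sum_le_sum fun i (_ : i ∈ Finset.univ) => hpt i) hn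
  simp only [Finset.sum_add_distrib, Finset.sum_sub_distrib, ← Finset.mul_sum] at hsum
  have q1 := abs_le.1 (h₁ η u)
  have q1' : κ₁ * ‖η‖ * ‖u‖ ≤ κ₁ * r₁ := by
    calc κ₁ * ‖η‖ * ‖u‖ ≤ κ₁ * ‖η‖ * 1 := by gcongr
      _ ≤ κ₁ * r₁ := by rw [mul_one]; gcongr
  have q2A := mul_le_mul_of_nonneg_left (h₂ A hA) hr₀.le
  have q2B := mul_le_mul_of_nonneg_left (h₂ B hB) hr₁.le
  have q2u := mul_le_mul_of_nonneg_left (h₂ u hu) (add_pos hr₀ hr₁).le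
  have q3A := mul_le_mul_of_nonneg_left (h₃ A hA) (add_pos hr₀ hr₁).le
  have q3B := mul_le_mul_of_nonneg_left (h₃ B hB) (add_pos hr₀ hr₁).le
  have q3u := mul_le_mul_of_nonneg_left (h₃ u hu) (add_pos hr₀ hr₁).le
  have q5 := h₅ u hu
  nlinarith

/-- If the linearization error `R` and the size `κ₄` of the score satisfy `R + κ₄ < r₁`, then every
minimizer of the Huber loss lies in the ball of radius `r₁` and agrees with the score up to `R`. -/
theorem huber_bahadur {n : ℕ} {τ r₁ R κ₄ : ℝ} (hτ : 0 < τ) (hr₁ : 0 < r₁) (hR : 0 ≤ R)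
    (hlt : R + κ₄ < r₁) (w : Fin n → E) (o g : Fin n → ℝ)
    (hlin : ∀ η : E, ‖η‖ ≤ r₁ → ∀ u : E, ‖u‖ ≤ 1 →
      (1 / n : ℝ) * ∑ i, (huberScore τ (o i + g i - ⟪w i, η⟫) - huberScore τ (o i)) * ⟪w i, u⟫
        + ⟪η, u⟫ ≤ R)
    (h₄ : ‖(1 / n : ℝ) • ∑ i, huberScore τ (o i) • w i‖ ≤ κ₄) (h : E)
    (hmin : ∀ η : E, ∑ i, huberLoss τ (⟪w i, h⟫ - (o i + g i)) ≤
      ∑ i, huberLoss τ (⟪w i, η⟫ - (o i + g i))) :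
    ‖h - (1 / n : ℝ) • ∑ i, huberScore τ (o i) • w i‖ ≤ R := by
  set s : E := (1 / n : ℝ) • ∑ i, huberScore τ (o i) • w i
  have hs : ∀ u, ⟪s, u⟫ = (1 / n : ℝ) * ∑ i, huberScore τ (o i) * ⟪w i, u⟫ := by
    intro u
    simp only [s, inner_smul_left, sum_inner]
    simp
  have hfoc := huber_firstOrder hτ w (fun i => o i + g i) h hmin
  have hball : ‖h‖ ≤ r₁ := by
    by_contra hc
    rw [not_le] at hc
    have hpos : 0 < ‖h‖ := hr₁.trans hc
    set c : ℝ := r₁ / ‖h‖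
    have hc1 : 0 < c := by positivity
    have hc2 : c < 1 := (div_lt_one hpos).2 hc
    -- Compare the estimating function at `h`, where it vanishes, with the point of the segment
    -- `[0, h]` on the sphere of radius `r₁`.
    have hcn : ‖c • h‖ = r₁ := by
      rw [norm_smul, Real.norm_of_nonneg hc1.le]
      simp only [c]
      field_simp
    have hmono : 0 ≤ ∑ i, huberScore τ (o i + g i - ⟪w i, c • h⟫) * ⟪w i, h⟫ := by
      rw [← hfoc h]
      refine Finset.sum_le_sum fun i _ => ?_
      rw [inner_smul_right]
      rcases le_total 0 ⟪w i, h⟫ with hi | hi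
      · exact mul_le_mul_of_nonneg_right (huberScore_monotone τ (by nlinarith)) hi
      · exact mul_le_mul_of_nonpos_right (huberScore_monotone τ (by nlinarith)) hi
    have hu : ‖‖h‖⁻¹ • h‖ = 1 := by
      rw [norm_smul, norm_inv, norm_norm, inv_mul_cancel₀ hpos.ne']
    have h1 := hlin (c • h) hcn.le (‖h‖⁻¹ • h) hu.le
    have h2 : ⟪c • h, ‖h‖⁻¹ • h⟫ = r₁ := by
      rw [inner_smul_left, inner_smul_right, real_inner_self_eq_norm_sq]
      simp only [c, conj_trivial]
      field_simp
    have h3 : ⟪s, ‖h‖⁻¹ • h⟫ ≤ κ₄ := (real_inner_le_norm _ _).trans (by rwa [hu, mul_one])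
    rw [hs] at h3
    have h4 : 0 ≤ (1 / n : ℝ) *
        ∑ i, huberScore τ (o i + g i - ⟪w i, c • h⟫) * ⟪w i, ‖h‖⁻¹ • h⟫ := by
      have : ∑ i, huberScore τ (o i + g i - ⟪w i, c • h⟫) * ⟪w i, ‖h‖⁻¹ • h⟫
          = ‖h‖⁻¹ * ∑ i, huberScore τ (o i + g i - ⟪w i, c • h⟫) * ⟪w i, h⟫ := by
        rw [Finset.mul_sum]
        refine Finset.sum_congr rfl fun i _ => ?_
        rw [show ⟪w i, ‖h‖⁻¹ • h⟫ = ‖h‖⁻¹ * ⟪w i, h⟫ from inner_smul_right _ _ _]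
        ring
      rw [this]
      positivity
    simp only [sub_mul, Finset.sum_sub_distrib, mul_sub] at h1
    rw [h2] at h1
    linarith
  refine norm_le_of_inner_le hR fun u hu => ?_
  have h1 := hlin h hball u hu
  simp only [sub_mul, Finset.sum_sub_distrib, mul_sub] at h1
  rw [hfoc u, mul_zero] at h1
  rw [inner_sub_left, hs]
  linarith

end Deterministic

/-! ### Finite nets of the unit ball -/

section Nets

open Metric Module ENNReal

variable {E : Type*} [NormedAddCommGroup E] [NormedSpace ℝ E] [FiniteDimensional ℝ E]

open scoped Function in
/-- Volume bound for the cardinality of a `ρ`-separated set in the unit ball. -/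
lemma card_le_of_separated_unitBall {ρ : ℝ} (hρ : 0 < ρ) (hρ1 : ρ ≤ 1) (s : Finset E)
    (hs : ∀ c ∈ s, ‖c‖ ≤ 1) (h : ∀ c ∈ s, ∀ d ∈ s, c ≠ d → ρ ≤ ‖c - d‖) :
    (s.card : ℝ) ≤ (3 / ρ) ^ finrank ℝ E := by
  borelize E
  let μ : Measure E := Measure.addHaar
  have D : Set.Pairwise (s : Set E) (Disjoint on fun c => ball (c : E) (ρ / 2)) := by
    rintro c hc d hd hcd
    apply ball_disjoint_ball
    rw [dist_eq_norm]
    linarith [h c hc d hd hcd]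
  set A := ⋃ c ∈ s, ball (c : E) (ρ / 2) with hA
  have A_subset : A ⊆ ball (0 : E) (3 / 2) := by
    refine iUnion₂_subset fun x hx => ball_subset_ball' ?_
    rw [dist_zero_right]
    linarith [hs x hx]
  have I : (s.card : ℝ≥0∞) * ENNReal.ofReal ((ρ / 2) ^ finrank ℝ E) * μ (ball 0 1) ≤
      ENNReal.ofReal ((3 / 2) ^ finrank ℝ E) * μ (ball 0 1) :=
    calc
      _ = μ A := by
        rw [hA, measure_biUnion_finset D fun c _ => measurableSet_ball]
        simp only [μ.addHaar_ball_of_pos _ (half_pos hρ), Finset.sum_const, nsmul_eq_mul, mul_assoc]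
      _ ≤ μ (ball (0 : E) (3 / 2)) := measure_mono A_subset
      _ = _ := by simp only [μ.addHaar_ball_of_pos _ (by norm_num : (0 : ℝ) < 3 / 2)]
  have J := (ENNReal.mul_le_mul_iff_left (measure_ball_pos _ _ zero_lt_one).ne'
    measure_ball_lt_top.ne).1 I
  have K := ENNReal.toReal_le_of_le_ofReal (by positivity) J
  rw [ENNReal.toReal_mul, ENNReal.toReal_natCast, ENNReal.toReal_ofReal (by positivity)] at K
  have e : (3 / ρ) ^ finrank ℝ E = (3 / 2) ^ finrank ℝ E / (ρ / 2) ^ finrank ℝ E := by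
    rw [← div_pow]
    congr 1
    field_simp
  rw [e, le_div_iff₀ (by positivity)]
  exact K

/-- The unit ball has a `ρ`-net of at most `(3 / ρ) ^ dim` points: a maximal separated subset. -/
lemma exists_finset_net {ρ : ℝ} (hρ : 0 < ρ) (hρ1 : ρ ≤ 1) :
    ∃ N : Finset E, (N.card : ℝ) ≤ (3 / ρ) ^ finrank ℝ E ∧ (∀ v ∈ N, ‖v‖ ≤ 1) ∧
      ∀ v : E, ‖v‖ ≤ 1 → ∃ v' ∈ N, ‖v - v'‖ ≤ ρ := by
  classical
  let S : Set ℕ := {k | ∃ s : Finset E, s.card = k ∧ (∀ c ∈ s, ‖c‖ ≤ 1) ∧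
    ∀ c ∈ s, ∀ d ∈ s, c ≠ d → ρ ≤ ‖c - d‖}
  have hbdd : BddAbove S := by
    refine ⟨⌊(3 / ρ) ^ finrank ℝ E⌋₊, ?_⟩
    rintro k ⟨s, rfl, h1, h2⟩
    exact Nat.le_floor (card_le_of_separated_unitBall hρ hρ1 s h1 h2)
  have hne : S.Nonempty := ⟨0, ∅, by simp⟩
  obtain ⟨N, hN, h1, h2⟩ := Nat.sSup_mem hne hbdd
  refine ⟨N, card_le_of_separated_unitBall hρ hρ1 N h1 h2, h1, fun v hv => ?_⟩
  by_contra! hc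
  have hvN : v ∉ N := fun hvN => by
    have := hc v hvN
    simp at this
    linarith
  have hmem : N.card + 1 ∈ S := by
    refine ⟨insert v N, Finset.card_insert_of_notMem hvN, ?_, ?_⟩
    · intro c hc'
      rcases Finset.mem_insert.1 hc' with rfl | hc'
      · exact hv
      · exact h1 c hc'
    · intro c hcm d hdm hcd
      rcases Finset.mem_insert.1 hcm with rfl | hc' <;> rcases Finset.mem_insert.1 hdm with rfl | hd'
      · exact absurd rfl hcd
      · exact (hc d hd').le
      · rw [norm_sub_rev]
        exact (hc c hc').le
      · exact h2 c hc' d hd' hcd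
  have := le_csSup hbdd hmem
  omega

end Nets

section NetSup

variable {E : Type*} [NormedAddCommGroup E] [InnerProductSpace ℝ E]

/-- A subadditive homogeneous functional bounded by `c` on a `1/2`-net of the unit ball is bounded by
`2c` on the unit ball. -/
lemma le_two_mul_of_net {N : Finset E} (hN : ∀ v : E, ‖v‖ ≤ 1 → ∃ v' ∈ N, ‖v - v'‖ ≤ 1 / 2)
    (q : E → ℝ) (hadd : ∀ u v, q (u + v) ≤ q u + q v)
    (hsmul : ∀ (r : ℝ) v, 0 ≤ r → q (r • v) = r * q v)
    {M : ℝ} (hM : ∀ v, ‖v‖ ≤ 1 → q v ≤ M) {c : ℝ} (hc : ∀ v ∈ N, q v ≤ c) (v : E) (hv : ‖v‖ ≤ 1) :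
    q v ≤ 2 * c := by
  -- The least upper bound `s` on the ball satisfies `s ≤ c + s / 2`.
  set S : Set ℝ := q '' {v | ‖v‖ ≤ 1}
  have hbdd : BddAbove S := ⟨M, by rintro _ ⟨v, hv, rfl⟩; exact hM v hv⟩
  have hne : S.Nonempty := ⟨q 0, 0, by simp, rfl⟩
  have hle : ∀ v, ‖v‖ ≤ 1 → q v ≤ sSup S := fun v hv => le_csSup hbdd ⟨v, hv, rfl⟩
  have hs : sSup S ≤ c + sSup S / 2 := by
    refine csSup_le hne ?_
    rintro _ ⟨v, hv, rfl⟩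
    obtain ⟨v', hv', hd⟩ := hN v hv
    have h1 : q v ≤ q v' + q (v - v') := by
      have := hadd v' (v - v')
      rwa [add_sub_cancel] at this
    have h2 : q (v - v') = 1 / 2 * q ((2 : ℝ) • (v - v')) := by
      rw [hsmul _ _ (by norm_num)]
      ring
    have h3 := hle ((2 : ℝ) • (v - v')) (by rw [norm_smul]; norm_num; linarith)
    have h4 := hc v' hv'
    linarith
  linarith [hle v hv]

/-- The analogue of `le_two_mul_of_net` for quadratic forms. -/
lemma quadratic_le_four_mul_of_net {N : Finset E}
    (hN : ∀ v : E, ‖v‖ ≤ 1 → ∃ v' ∈ N, ‖v - v'‖ ≤ 1 / 2)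
    (q : E → ℝ) (hadd : ∀ u v, q (u + v) ≤ 2 * q u + 2 * q v)
    (hsmul : ∀ (r : ℝ) v, q (r • v) = r ^ 2 * q v)
    {M : ℝ} (hM : ∀ v, ‖v‖ ≤ 1 → q v ≤ M) {c : ℝ} (hc : ∀ v ∈ N, q v ≤ c) (v : E) (hv : ‖v‖ ≤ 1) :
    q v ≤ 4 * c := by
  set S : Set ℝ := q '' {v | ‖v‖ ≤ 1}
  have hbdd : BddAbove S := ⟨M, by rintro _ ⟨v, hv, rfl⟩; exact hM v hv⟩
  have hne : S.Nonempty := ⟨q 0, 0, by simp, rfl⟩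
  have hle : ∀ v, ‖v‖ ≤ 1 → q v ≤ sSup S := fun v hv => le_csSup hbdd ⟨v, hv, rfl⟩
  have hs : sSup S ≤ 2 * c + sSup S / 2 := by
    refine csSup_le hne ?_
    rintro _ ⟨v, hv, rfl⟩
    obtain ⟨v', hv', hd⟩ := hN v hv
    have h1 : q v ≤ 2 * q v' + 2 * q (v - v') := by
      have := hadd v' (v - v')
      rwa [add_sub_cancel] at this
    have h2 : q (v - v') = 1 / 4 * q ((2 : ℝ) • (v - v')) := by
      rw [hsmul]
      ring
    have h3 := hle ((2 : ℝ) • (v - v')) (by rw [norm_smul]; norm_num; linarith)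
    have h4 := hc v' hv'
    linarith
  linarith [hle v hv]

lemma norm_le_two_mul_of_net {N : Finset E}
    (hN : ∀ v : E, ‖v‖ ≤ 1 → ∃ v' ∈ N, ‖v - v'‖ ≤ 1 / 2) (V : E) {c : ℝ}
    (hc : ∀ v ∈ N, ⟪V, v⟫ ≤ c) : ‖V‖ ≤ 2 * c := by
  have h := le_two_mul_of_net hN (fun v => ⟪V, v⟫) (fun u v => (inner_add_right _ _ _).le)
    (fun r v _ => inner_smul_right _ _ _) (M := ‖V‖)
    (fun v hv => (real_inner_le_norm _ _).trans (by nlinarith [norm_nonneg V])) hc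
  refine norm_le_of_inner_le ?_ h
  simpa using h 0 (by simp)

lemma norm_apply_le_four_mul_of_net {N : Finset E}
    (hN : ∀ v : E, ‖v‖ ≤ 1 → ∃ v' ∈ N, ‖v - v'‖ ≤ 1 / 2) (T : E →L[ℝ] E) {c : ℝ}
    (hc : ∀ v ∈ N, ∀ u ∈ N, ⟪T v, u⟫ ≤ c) (v : E) : ‖T v‖ ≤ 4 * c * ‖v‖ := by
  have h := le_two_mul_of_net hN (fun v => ‖T v‖)
    (fun u v => by simpa using norm_add_le (T u) (T v))
    (fun r v hr => by simp [norm_smul, abs_of_nonneg hr]) (M := ‖T‖)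
    (fun v hv => (T.le_opNorm v).trans (by nlinarith [norm_nonneg T]))
    (fun v hv => norm_le_two_mul_of_net hN (T v) (hc v hv))
  rcases eq_or_ne v 0 with rfl | hv
  · simp
  have hn : 0 < ‖v‖ := norm_pos_iff.2 hv
  have h1 := h (‖v‖⁻¹ • v) (by rw [norm_smul, norm_inv, norm_norm, inv_mul_cancel₀ hn.ne'])
  simp only [map_smul, norm_smul, norm_inv, norm_norm] at h1
  rw [inv_mul_le_iff₀ hn] at h1
  linarith

end NetSup

/-! ### Chernoff bounds over finite families -/

section Chernoff

variable {Z : Type*} [MeasurableSpace Z] (P : Measure Z) [IsProbabilityMeasure P]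

lemma lintegral_exp_sum_pi_le {n : ℕ} {A : Z → ℝ} (hA : Measurable A) {m : ℝ}
    (hm : ∫⁻ z, ENNReal.ofReal (Real.exp (A z)) ∂P ≤ ENNReal.ofReal (Real.exp m)) :
    ∫⁻ x, ENNReal.ofReal (Real.exp (∑ i, A (x i))) ∂(Measure.pi fun _ : Fin n => P) ≤
      ENNReal.ofReal (Real.exp (n * m)) := by
  have hmeas : Measurable fun z => ENNReal.ofReal (Real.exp (A z)) := by fun_prop
  have hind : iIndepFun (fun (i : Fin n) (x : Fin n → Z) => ENNReal.ofReal (Real.exp (A (x i))))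
      (Measure.pi fun _ => P) :=
    iIndepFun_pi (X := fun (_ : Fin n) z => ENNReal.ofReal (Real.exp (A z)))
      (fun _ => hmeas.aemeasurable)
  have h1 : ∀ x : Fin n → Z, ENNReal.ofReal (Real.exp (∑ i, A (x i))) =
      ∏ i, ENNReal.ofReal (Real.exp (A (x i))) := by
    intro x
    rw [Real.exp_sum, ENNReal.ofReal_prod_of_nonneg fun i _ => (Real.exp_pos _).le]
  simp only [h1]
  rw [lintegral_prod_eq_prod_lintegral_of_indepFun Finset.univ _ hind
    (fun i => hmeas.comp (measurable_pi_apply i))]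
  have h2 : ∀ i : Fin n, ∫⁻ x : Fin n → Z, ENNReal.ofReal (Real.exp (A (x i)))
      ∂(Measure.pi fun _ => P) = ∫⁻ z, ENNReal.ofReal (Real.exp (A z)) ∂P := fun i =>
    (measurePreserving_eval (fun _ : Fin n => P) i).lintegral_comp hmeas
  simp only [h2, Finset.prod_const, Finset.card_univ, Fintype.card_fin]
  rw [Real.exp_nat_mul, ENNReal.ofReal_pow (Real.exp_pos _).le]
  gcongr

/-- Chernoff bound with a union bound over a family of at most `e^L` exponents. -/
lemma measure_exists_sum_ge_le {n : ℕ} {ι : Type*} (N : Finset ι) (A : ι → Z → ℝ)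
    (hA : ∀ v, Measurable (A v)) {m : ι → ℝ} {L : ℝ} (t : ℝ) (hN : (N.card : ℝ) ≤ Real.exp L)
    (hm : ∀ v ∈ N, ∫⁻ z, ENNReal.ofReal (Real.exp (A v z)) ∂P ≤ ENNReal.ofReal (Real.exp (m v))) :
    (Measure.pi fun _ : Fin n => P) {x | ∃ v ∈ N, n * m v + L + t ≤ ∑ i, A v (x i)} ≤
      ENNReal.ofReal (Real.exp (-t)) := by
  set Q := Measure.pi fun _ : Fin n => P
  have hmeas : ∀ v, Measurable fun x : Fin n → Z => ENNReal.ofReal (Real.exp (∑ i, A v (x i))) :=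
    fun v => (Real.measurable_exp.comp (Finset.measurable_sum _ fun i _ =>
      (hA v).comp (measurable_pi_apply i))).ennreal_ofReal
  have h1 : ∀ v ∈ N, Q {x | n * m v + L + t ≤ ∑ i, A v (x i)} ≤ ENNReal.ofReal (Real.exp (-L - t)) := by
    intro v hv
    have hmk := meas_ge_le_lintegral_div (μ := Q)
      (f := fun x => ENNReal.ofReal (Real.exp (∑ i, A v (x i)))) (hmeas v).aemeasurable
      (ε := ENNReal.ofReal (Real.exp (n * m v + L + t)))
      (by simp [Real.exp_pos]) ENNReal.ofReal_ne_top
    have hset : {x : Fin n → Z | n * m v + L + t ≤ ∑ i, A v (x i)} = {x | ENNReal.ofReal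
        (Real.exp (n * m v + L + t)) ≤ ENNReal.ofReal (Real.exp (∑ i, A v (x i)))} := by
      ext x
      simp only [mem_ofPred_eq]
      rw [ENNReal.ofReal_le_ofReal_iff (Real.exp_pos _).le, Real.exp_le_exp]
    rw [hset]
    refine hmk.trans ((ENNReal.div_le_div_right (lintegral_exp_sum_pi_le P (hA v) (hm v hv)) _).trans
      (le_of_eq ?_))
    rw [← ENNReal.ofReal_div_of_pos (Real.exp_pos _), ← Real.exp_sub]
    congr 2
    ring
  have hset : {x : Fin n → Z | ∃ v ∈ N, n * m v + L + t ≤ ∑ i, A v (x i)} =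
      ⋃ v ∈ N, {x | n * m v + L + t ≤ ∑ i, A v (x i)} := by
    ext x
    simp
  rw [hset]
  refine (measure_biUnion_finset_le _ _).trans ((Finset.sum_le_sum h1).trans ?_)
  rw [Finset.sum_const, nsmul_eq_mul, ← ENNReal.ofReal_natCast,
    ← ENNReal.ofReal_mul (by positivity)]
  apply ENNReal.ofReal_le_ofReal
  calc (N.card : ℝ) * Real.exp (-L - t) ≤ Real.exp L * Real.exp (-L - t) := by gcongr
    _ = Real.exp (-t) := by rw [← Real.exp_add]; congr 1; ring

lemma exp_le_one_add_add_sq_mul_exp_abs (x : ℝ) :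
    Real.exp x ≤ 1 + x + x ^ 2 * Real.exp |x| := by
  have h1 : 1 ≤ Real.exp |x| := Real.one_le_exp (abs_nonneg x)
  have h2 : x ^ 2 ≤ x ^ 2 * Real.exp |x| := le_mul_of_one_le_right (sq_nonneg x) h1
  rcases le_total |x| 1 with h | h
  · have := Real.norm_exp_sub_one_sub_id_le (x := x) h
    rw [Real.norm_eq_abs, Real.norm_eq_abs, sq_abs] at this
    linarith [le_abs_self (Real.exp x - 1 - x)]
  · rcases abs_cases x with ⟨hx, h0⟩ | ⟨hx, h0⟩
    · rw [hx] at h ⊢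
      have : Real.exp x ≤ x ^ 2 * Real.exp x :=
        le_mul_of_one_le_left (Real.exp_pos x).le (by nlinarith)
      linarith
    · have : Real.exp x ≤ 1 := Real.exp_le_one_iff.2 h0.le
      nlinarith

/-- Bennett-type bound on the moment generating function from a tilted second moment. -/
lemma lintegral_exp_mul_le {f : Z → ℝ} (hf : Integrable f P) {s m V : ℝ} (hs : 0 ≤ s)
    (hV0 : 0 ≤ V) (hm : ∫ z, f z ∂P ≤ m)
    (hV : ∫⁻ z, ENNReal.ofReal (f z ^ 2 * Real.exp (s * |f z|)) ∂P ≤ ENNReal.ofReal V) :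
    ∫⁻ z, ENNReal.ofReal (Real.exp (s * f z)) ∂P ≤
      ENNReal.ofReal (Real.exp (s * m + s ^ 2 * V)) := by
  have hmeas : AEStronglyMeasurable (fun z => f z ^ 2 * Real.exp (s * |f z|)) P := by
    have := hf.1.aemeasurable
    exact AEMeasurable.aestronglyMeasurable (by fun_prop)
  have hint : Integrable (fun z => f z ^ 2 * Real.exp (s * |f z|)) P := by
    refine ⟨hmeas, ?_⟩
    rw [hasFiniteIntegral_iff_ofReal (Filter.Eventually.of_forall fun z => by positivity)]
    exact hV.trans_lt ENNReal.ofReal_lt_top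
  have hint2 : ∫ z, f z ^ 2 * Real.exp (s * |f z|) ∂P ≤ V := by
    rw [integral_eq_lintegral_of_nonneg_ae (Filter.Eventually.of_forall fun z => by positivity)
      hmeas]
    exact ENNReal.toReal_le_of_le_ofReal hV0 hV
  have hpt : ∀ z, Real.exp (s * f z) ≤ 1 + s * f z + s ^ 2 * (f z ^ 2 * Real.exp (s * |f z|)) := by
    intro z
    have := exp_le_one_add_add_sq_mul_exp_abs (s * f z)
    rw [abs_mul, abs_of_nonneg hs] at this
    linarith [this]
  have hI1 : Integrable (fun z => 1 + s * f z) P := (integrable_const _).add (hf.const_mul s)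
  have hI := hI1.add (hint.const_mul (s ^ 2))
  calc ∫⁻ z, ENNReal.ofReal (Real.exp (s * f z)) ∂P
      ≤ ∫⁻ z, ENNReal.ofReal (1 + s * f z + s ^ 2 * (f z ^ 2 * Real.exp (s * |f z|))) ∂P :=
        lintegral_mono fun z => ENNReal.ofReal_le_ofReal (hpt z)
    _ = ENNReal.ofReal (∫ z, (1 + s * f z + s ^ 2 * (f z ^ 2 * Real.exp (s * |f z|))) ∂P) :=
        (ofReal_integral_eq_lintegral_ofReal hI (Filter.Eventually.of_forall fun z =>
          (Real.exp_pos _).le.trans (hpt z))).symm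
    _ ≤ _ := by
        apply ENNReal.ofReal_le_ofReal
        have h1 : ∫ z, (1 + s * f z + s ^ 2 * (f z ^ 2 * Real.exp (s * |f z|))) ∂P =
            1 + s * ∫ z, f z ∂P + s ^ 2 * ∫ z, f z ^ 2 * Real.exp (s * |f z|) ∂P := by
          rw [integral_add hI1 (hint.const_mul _), integral_add (integrable_const _)
            (hf.const_mul s), integral_const_mul, integral_const_mul]
          simp
        rw [h1]
        have h2 := Real.add_one_le_exp (s * m + s ^ 2 * V)
        have h3 := mul_le_mul_of_nonneg_left hm hs
        have h4 := mul_le_mul_of_nonneg_left hint2 (sq_nonneg s)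
        linarith

end Chernoff

/-! ### The standardized model -/

/-- Effect on the ES residual of moving the quantile fit by `s`, at quantile residual `e`:
`min(e - s, 0) - min(e, 0) + α s`. -/
def hingeIncr (α e s : ℝ) : ℝ := min (e - s) 0 - min e 0 + α * s

lemma abs_hingeIncr_sub_le {α : ℝ} (h0 : 0 ≤ α) (h1 : α ≤ 1) (e s s' : ℝ) :
    |hingeIncr α e s - hingeIncr α e s'| ≤ |s - s'| := by
  have key : ∀ a b : ℝ, a ≤ b → 0 ≤ min (e - a) 0 - min (e - b) 0 ∧
      min (e - a) 0 - min (e - b) 0 ≤ b - a := by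
    intro a b hab
    constructor <;> grind
  unfold hingeIncr
  rcases le_total s s' with h | h
  · obtain ⟨h2, h3⟩ := key s s' h
    rw [abs_of_nonpos (by linarith : s - s' ≤ 0), abs_le]
    constructor <;> nlinarith
  · obtain ⟨h2, h3⟩ := key s' s h
    rw [abs_of_nonneg (by linarith : 0 ≤ s - s'), abs_le]
    constructor <;> nlinarith

lemma abs_hingeIncr_le {α : ℝ} (h0 : 0 ≤ α) (h1 : α ≤ 1) (e s : ℝ) : |hingeIncr α e s| ≤ |s| := by
  have h := abs_hingeIncr_sub_le h0 h1 e s 0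
  have h2 : hingeIncr α e 0 = 0 := by simp [hingeIncr]
  simpa [h2] using h

/-- A random vector `w` all of whose projections on the unit ball have a squared exponential moment,
`E exp(lam (wᵀv)²) ≤ 3`. The constant `lam` plays the role of an inverse squared sub-Gaussian norm. -/
structure SubGaussianDesign {p : ℕ} {Z : Type*} [MeasurableSpace Z] (P : Measure Z) (w : Z → Vec p)
    (lam : ℝ) : Prop where
  measurable_w : Measurable w
  lam_pos : 0 < lam
  lam_le : lam ≤ 1 / 4
  lintegral_exp_sq : ∀ v : Vec p, ‖v‖ ≤ 1 →
    ∫⁻ z, ENNReal.ofReal (Real.exp (lam * ⟪w z, v⟫ ^ 2)) ∂P ≤ ENNReal.ofReal 3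

/-- One observation in standardized coordinates: `w` is the isotropic covariate, `e` the quantile
residual and `o` the ES residual. The last three fields are the moment consequences of the conditional
model that the argument uses: conditional variance at most `σ²`, conditional mean zero, and a quadratic
bound `f s²` on the conditional mean of `hingeIncr α e s`. -/
structure StandardizedModel {p : ℕ} {Z : Type*} [MeasurableSpace Z] (P : Measure Z) (w : Z → Vec p)
    (e o : Z → ℝ) (α lam f σ : ℝ) : Prop extends SubGaussianDesign P w lam where
  measurable_e : Measurable e
  measurable_o : Measurable o
  alpha_nonneg : 0 ≤ α
  alpha_le_one : α ≤ 1
  f_nonneg : 0 ≤ f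
  σ_pos : 0 < σ
  integral_inner_mul_inner : ∀ u v : Vec p, ∫ z, ⟪w z, u⟫ * ⟪w z, v⟫ ∂P = ⟪u, v⟫
  lintegral_mul_sq_le : ∀ h : Vec p → ℝ, Measurable h → (∀ x, 0 ≤ h x) →
    ∫⁻ z, ENNReal.ofReal (h (w z) * o z ^ 2) ∂P ≤
      ENNReal.ofReal (σ ^ 2) * ∫⁻ z, ENNReal.ofReal (h (w z)) ∂P
  integral_mul_inner : ∀ u : Vec p, ∫ z, o z * ⟪w z, u⟫ ∂P = 0
  integral_hingeIncr_le : ∀ δ u : Vec p, ∫ z, hingeIncr α (e z) ⟪w z, δ⟫ * ⟪w z, u⟫ ∂P ≤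
    f * ∫ z, ⟪w z, δ⟫ ^ 2 * |⟪w z, u⟫| ∂P

lemma exp_half_add_le (x y : ℝ) : Real.exp ((x + y) / 2) ≤ (Real.exp x + Real.exp y) / 2 := by
  have hx : Real.exp x = Real.exp (x / 2) ^ 2 := by rw [← Real.exp_nat_mul]; congr 1; push_cast; ring
  have hy : Real.exp y = Real.exp (y / 2) ^ 2 := by rw [← Real.exp_nat_mul]; congr 1; push_cast; ring
  rw [add_div, Real.exp_add, hx, hy]
  nlinarith [sq_nonneg (Real.exp (x / 2) - Real.exp (y / 2))]

lemma sq_le_two_mul_exp {y : ℝ} (hy : 0 ≤ y) : y ^ 2 ≤ 2 * Real.exp y := by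
  have := Real.quadratic_le_exp_of_nonneg hy
  linarith

lemma six_pow_le_exp (p : ℕ) : (3 / (1 / 2) : ℝ) ^ p ≤ Real.exp (2 * p) := by
  have h6 : (3 / (1 / 2) : ℝ) ≤ Real.exp 2 := by
    have h := Real.exp_one_gt_d9
    have : Real.exp 2 = Real.exp 1 ^ 2 := by rw [← Real.exp_nat_mul]; norm_num
    rw [this]
    nlinarith
  calc (3 / (1 / 2) : ℝ) ^ p ≤ Real.exp 2 ^ p := by gcongr
    _ = Real.exp (2 * p) := by rw [← Real.exp_nat_mul, mul_comm]

namespace SubGaussianDesign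

variable {p : ℕ} {Z : Type*} [MeasurableSpace Z] {P : Measure Z}
  {w : Z → Vec p} {lam : ℝ}

lemma measurable_inner (M : SubGaussianDesign P w lam) (v : Vec p) :
    Measurable fun z => ⟪w z, v⟫ := M.measurable_w.inner_const

lemma lintegral_le_of_le_exp (M : SubGaussianDesign P w lam) {u v : Vec p} (hu : ‖u‖ ≤ 1)
    (hv : ‖v‖ ≤ 1) {F : Z → ℝ} {C : ℝ} (hC : 0 ≤ C)
    (hF : ∀ z, F z ≤
      C * ((Real.exp (lam * ⟪w z, u⟫ ^ 2) + Real.exp (lam * ⟪w z, v⟫ ^ 2)) / 2)) :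
    ∫⁻ z, ENNReal.ofReal (F z) ∂P ≤ ENNReal.ofReal (3 * C) := by
  have hmu := M.measurable_inner u
  have hmv := M.measurable_inner v
  calc ∫⁻ z, ENNReal.ofReal (F z) ∂P
      ≤ ∫⁻ z, (ENNReal.ofReal (C / 2) * ENNReal.ofReal (Real.exp (lam * ⟪w z, u⟫ ^ 2)) +
          ENNReal.ofReal (C / 2) * ENNReal.ofReal (Real.exp (lam * ⟪w z, v⟫ ^ 2))) ∂P := by
        refine lintegral_mono fun z => ?_
        rw [← ENNReal.ofReal_mul (by positivity), ← ENNReal.ofReal_mul (by positivity),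
          ← ENNReal.ofReal_add (by positivity) (by positivity)]
        refine ENNReal.ofReal_le_ofReal ((hF z).trans (le_of_eq ?_))
        ring
    _ = ENNReal.ofReal (C / 2) * ∫⁻ z, ENNReal.ofReal (Real.exp (lam * ⟪w z, u⟫ ^ 2)) ∂P +
          ENNReal.ofReal (C / 2) * ∫⁻ z, ENNReal.ofReal (Real.exp (lam * ⟪w z, v⟫ ^ 2)) ∂P := by
        rw [lintegral_add_left (by fun_prop), lintegral_const_mul _ (by fun_prop),
          lintegral_const_mul _ (by fun_prop)]
    _ ≤ ENNReal.ofReal (C / 2) * ENNReal.ofReal 3 + ENNReal.ofReal (C / 2) * ENNReal.ofReal 3 := by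
        gcongr
        · exact M.lintegral_exp_sq u hu
        · exact M.lintegral_exp_sq v hv
    _ = ENNReal.ofReal (3 * C) := by
        rw [← ENNReal.ofReal_mul (by positivity),
          ← ENNReal.ofReal_add (by positivity) (by positivity)]
        congr 1
        ring

lemma integrable_of_abs_le_exp (M : SubGaussianDesign P w lam) {u v : Vec p}
    (hu : ‖u‖ ≤ 1) (hv : ‖v‖ ≤ 1) {F : Z → ℝ} (hFm : Measurable F) {C : ℝ} (hC : 0 ≤ C)
    (hF : ∀ z, |F z| ≤
      C * ((Real.exp (lam * ⟪w z, u⟫ ^ 2) + Real.exp (lam * ⟪w z, v⟫ ^ 2)) / 2)) :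
    Integrable F P ∧ |∫ z, F z ∂P| ≤ 3 * C := by
  have h := M.lintegral_le_of_le_exp hu hv hC hF
  have hint : Integrable F P := by
    refine ⟨hFm.aestronglyMeasurable, ?_⟩
    rw [hasFiniteIntegral_iff_norm]
    exact h.trans_lt ENNReal.ofReal_lt_top
  refine ⟨hint, (abs_integral_le_integral_abs).trans ?_⟩
  rw [integral_eq_lintegral_of_nonneg_ae (Filter.Eventually.of_forall fun z => abs_nonneg _)
    hFm.abs.aestronglyMeasurable]
  exact ENNReal.toReal_le_of_le_ofReal (by positivity) h

lemma abs_mul_abs_le_exp (M : SubGaussianDesign P w lam) (a b : ℝ) :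
    |a| * |b| ≤ 1 / lam * ((Real.exp (lam * a ^ 2) + Real.exp (lam * b ^ 2)) / 2) := by
  have hl := M.lam_pos
  have h1 := Real.add_one_le_exp (lam * a ^ 2)
  have h2 := Real.add_one_le_exp (lam * b ^ 2)
  rw [div_mul_eq_mul_div, one_mul, le_div_iff₀ hl]
  nlinarith [mul_nonneg hl.le (sq_nonneg (|a| - |b|)), sq_abs a, sq_abs b]

/-- Products of two linear functionals of `w` are sub-exponential. -/
lemma lintegral_sq_mul_exp_le (M : SubGaussianDesign P w lam) {u v : Vec p}
    (hu : ‖u‖ ≤ 1) (hv : ‖v‖ ≤ 1) {F : Z → ℝ} (hF : ∀ z, |F z| ≤ |⟪w z, u⟫| * |⟪w z, v⟫|)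
    {s : ℝ} (hs : s ≤ lam / 2) :
    ∫⁻ z, ENNReal.ofReal (F z ^ 2 * Real.exp (s * |F z|)) ∂P ≤ ENNReal.ofReal (24 / lam ^ 2) := by
  have hl := M.lam_pos
  have h := M.lintegral_le_of_le_exp hu hv (C := 8 / lam ^ 2)
    (F := fun z => F z ^ 2 * Real.exp (s * |F z|)) (by positivity) ?_
  · refine h.trans (le_of_eq ?_)
    congr 1
    ring
  intro z
  set a := ⟪w z, u⟫
  set b := ⟪w z, v⟫
  set Q := (a ^ 2 + b ^ 2) / 2
  have hQ0 : 0 ≤ Q := by positivity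
  have hQ : |F z| ≤ Q := (hF z).trans (by
    simp only [Q, a, b]
    nlinarith [sq_nonneg (|a| - |b|), sq_abs a, sq_abs b])
  have h1 : F z ^ 2 ≤ 8 / lam ^ 2 * Real.exp (lam / 2 * Q) := by
    have h2 := sq_le_two_mul_exp (y := lam / 2 * Q) (by positivity)
    have h3 : F z ^ 2 ≤ Q ^ 2 := by
      rw [← sq_abs]
      gcongr
    refine h3.trans ?_
    rw [div_mul_eq_mul_div, le_div_iff₀ (by positivity)]
    nlinarith
  have h4 : Real.exp (s * |F z|) ≤ Real.exp (lam / 2 * Q) := by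
    rw [Real.exp_le_exp]
    calc s * |F z| ≤ lam / 2 * |F z| := by gcongr
      _ ≤ lam / 2 * Q := by gcongr
  calc F z ^ 2 * Real.exp (s * |F z|)
      ≤ 8 / lam ^ 2 * Real.exp (lam / 2 * Q) * Real.exp (lam / 2 * Q) := by gcongr
    _ = 8 / lam ^ 2 * Real.exp ((lam * a ^ 2 + lam * b ^ 2) / 2) := by
        rw [mul_assoc, ← Real.exp_add]
        congr 2
        simp only [Q]
        ring
    _ ≤ _ := by
        gcongr
        exact exp_half_add_le _ _

/-- Third moments of linear functionals. -/
lemma integrable_sq_mul_abs (M : SubGaussianDesign P w lam) {u v : Vec p} (hu : ‖u‖ ≤ 1)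
    (hv : ‖v‖ ≤ 1) : Integrable (fun z => ⟪w z, v⟫ ^ 2 * |⟪w z, u⟫|) P ∧
      ∫ z, ⟪w z, v⟫ ^ 2 * |⟪w z, u⟫| ∂P ≤ 6 / lam ^ 2 := by
  have hl := M.lam_pos
  have hl4 := M.lam_le
  have h := M.integrable_of_abs_le_exp hv hu (F := fun z => ⟪w z, v⟫ ^ 2 * |⟪w z, u⟫|)
    (C := 2 / lam ^ 2) (((M.measurable_inner v).pow_const 2).mul (M.measurable_inner u).abs)
    (by positivity) fun z => ?_
  · exact ⟨h.1, (le_abs_self _).trans (h.2.trans (le_of_eq (by ring)))⟩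
  rw [abs_mul, abs_abs, abs_of_nonneg (sq_nonneg _)]
  set a := ⟪w z, v⟫
  set b := ⟪w z, u⟫
  have h2 := sq_le_two_mul_exp (y := lam * a ^ 2) (by positivity)
  have h3 := Real.add_one_le_exp (lam * b ^ 2)
  have h4 : a ^ 2 * |b| ≤ (a ^ 4 + b ^ 2) / 2 := by
    rw [← sq_abs b]
    nlinarith [sq_nonneg (a ^ 2 - |b|)]
  refine h4.trans ?_
  rw [div_mul_eq_mul_div, le_div_iff₀ (by positivity)]
  have h5 : lam ^ 2 * b ^ 2 ≤ lam * b ^ 2 :=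
    mul_le_mul_of_nonneg_right (by nlinarith) (sq_nonneg b)
  nlinarith [Real.exp_pos (lam * b ^ 2)]

end SubGaussianDesign

namespace StandardizedModel

variable {p : ℕ} {Z : Type*} [MeasurableSpace Z] {P : Measure Z}
  {w : Z → Vec p} {e o : Z → ℝ} {α lam f σ : ℝ}

lemma measurable_hingeIncr (M : StandardizedModel P w e o α lam f σ) (v : Vec p) :
    Measurable fun z => hingeIncr α (e z) ⟪w z, v⟫ := by
  have h1 := M.measurable_inner v
  have h2 := M.measurable_e
  unfold hingeIncr
  fun_prop

/-! ### Uniform deviation bounds -/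

variable [IsProbabilityMeasure P]

/-- Concentration of the sample Gram matrix. -/
lemma measure_gram_le (M : StandardizedModel P w e o α lam f σ) {n : ℕ} (hn : 0 < n) {t ζ : ℝ}
    (ht : 0 < t) (hζ : 0 < ζ) (hζ1 : ζ ≤ 1) (hnζ : n * ζ ^ 2 = p + t) :
    (Measure.pi fun _ : Fin n => P) {x | ¬ ∀ u v : Vec p,
      |(1 / n : ℝ) * ∑ i, ⟪w (x i), u⟫ * ⟪w (x i), v⟫ - ⟪u, v⟫| ≤ 80 / lam * ζ * ‖u‖ * ‖v‖} ≤
      ENNReal.ofReal (Real.exp (-t)) := by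
  have hl := M.lam_pos
  have hn' : (0 : ℝ) < n := by exact_mod_cast hn
  obtain ⟨N, hcard, hball, hnet⟩ := exists_finset_net (E := Vec p) (ρ := 1 / 2) (by norm_num)
    (by norm_num)
  rw [finrank_euclideanSpace_fin] at hcard
  set s : ℝ := lam / 2 * ζ
  have hs : 0 < s := by positivity
  have hsl : s ≤ lam / 2 := by simp only [s]; nlinarith
  refine le_trans (measure_mono ?_) (measure_exists_sum_ge_le P (n := n) (N ×ˢ N)
    (fun uv z => s * (⟪w z, uv.1⟫ * ⟪w z, uv.2⟫))
    (fun uv => ((M.measurable_inner uv.1).mul (M.measurable_inner uv.2)).const_mul s)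
    (m := fun uv => s * ⟪uv.1, uv.2⟫ + s ^ 2 * (24 / lam ^ 2)) (L := 4 * p) t ?_ ?_)
  · intro x hx
    by_contra hc
    apply hx
    simp only [mem_ofPred_eq, not_exists, not_and, not_le, Finset.mem_product, Prod.forall] at hc
    let T : Vec p →L[ℝ] Vec p :=
      (1 / n : ℝ) • ∑ i, (innerSL ℝ (w (x i))).smulRight (w (x i)) - ContinuousLinearMap.id ℝ _
    have hT : ∀ u v, ⟪T u, v⟫ = (1 / n : ℝ) * ∑ i, ⟪w (x i), u⟫ * ⟪w (x i), v⟫ - ⟪u, v⟫ := by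
      intro u v
      simp [T, inner_sub_left, inner_smul_left, sum_inner]
    have hTN : ∀ u ∈ N, ∀ v ∈ N, ⟪T u, v⟫ ≤ 20 / lam * ζ := by
      intro u hu v hv
      have h1 := hc u v ⟨hu, hv⟩
      rw [← Finset.mul_sum] at h1
      rw [hT]
      set S := ∑ i, ⟪w (x i), u⟫ * ⟪w (x i), v⟫
      have h2 : s * S < n * (s * (⟪u, v⟫ + 20 / lam * ζ)) := by
        have h3 : s * (20 / lam * ζ) = 10 * ζ ^ 2 := by
          simp only [s]
          field_simp
          ring
        have h4 : s ^ 2 * (24 / lam ^ 2) = 6 * ζ ^ 2 := by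
          simp only [s]
          field_simp
          ring
        rw [h4] at h1
        rw [mul_add, h3]
        nlinarith
      have h5 : S < n * (⟪u, v⟫ + 20 / lam * ζ) := by
        rw [mul_left_comm] at h2
        exact lt_of_mul_lt_mul_left h2 hs.le
      have h6 : (1 / n : ℝ) * S ≤ ⟪u, v⟫ + 20 / lam * ζ := by
        rw [one_div, inv_mul_le_iff₀ hn']
        exact h5.le
      linarith
    intro u v
    rw [← hT]
    refine (abs_real_inner_le_norm _ _).trans ?_
    have := norm_apply_le_four_mul_of_net hnet T hTN u
    refine mul_le_mul_of_nonneg_right (this.trans (le_of_eq ?_)) (norm_nonneg _)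
    ring
  · rw [Finset.card_product]
    push_cast
    have h := hcard.trans (six_pow_le_exp p)
    calc (N.card : ℝ) * N.card ≤ Real.exp (2 * p) * Real.exp (2 * p) := by gcongr
      _ = Real.exp (4 * p) := by rw [← Real.exp_add]; congr 1; ring
  · rintro ⟨u, v⟩ huv
    rw [Finset.mem_product] at huv
    have hu := hball u huv.1
    have hv := hball v huv.2
    have hint := (M.integrable_of_abs_le_exp hu hv (F := fun z => ⟪w z, u⟫ * ⟪w z, v⟫)
      ((M.measurable_inner u).mul (M.measurable_inner v)) (C := 1 / lam) (by positivity)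
      (fun z => by rw [abs_mul]; exact M.abs_mul_abs_le_exp _ _)).1
    exact lintegral_exp_mul_le P hint hs.le (by positivity) (M.integral_inner_mul_inner u v).le
      (M.lintegral_sq_mul_exp_le hu hv (fun z => (abs_mul _ _).le) hsl)

lemma measurable_absInd (T : ℝ) : Measurable (absInd T) := by
  unfold absInd
  exact Measurable.ite (measurableSet_lt measurable_const measurable_id.abs) measurable_const
    measurable_const

/-- Large noise rarely meets any direction: the noise exceeds `τ / 2` with conditional probability at
most `4 σ² / τ²`, by Chebyshev's inequality. -/
lemma measure_noise_truncation_le (M : StandardizedModel P w e o α lam f σ) {n : ℕ} (hn : 0 < n)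
    {t ζ c₁ τ : ℝ} (ht : 0 < t) (hnζ : n * ζ ^ 2 = p + t)
    (hτ : 0 < τ) (hστ : σ / τ ≤ ζ / c₁) :
    (Measure.pi fun _ : Fin n => P) {x | ¬ ∀ v : Vec p, ‖v‖ ≤ 1 →
      (1 / n : ℝ) * ∑ i, ⟪w (x i), v⟫ ^ 2 * absInd (τ / 2) (o (x i)) ≤
        4 * (12 / c₁ ^ 2 + 2) / lam * ζ ^ 2} ≤
      ENNReal.ofReal (Real.exp (-t)) := by
  have hl := M.lam_pos
  have hn' : (0 : ℝ) < n := by exact_mod_cast hn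
  obtain ⟨N, hcard, hball, hnet⟩ := exists_finset_net (E := Vec p) (ρ := 1 / 2) (by norm_num)
    (by norm_num)
  rw [finrank_euclideanSpace_fin] at hcard
  have hmo := M.measurable_o
  have hmeas : ∀ v, Measurable fun z => lam * (⟪w z, v⟫ ^ 2 * absInd (τ / 2) (o z)) := fun v =>
    (((M.measurable_inner v).pow_const 2).mul ((measurable_absInd _).comp hmo)).const_mul lam
  refine le_trans (measure_mono ?_) (measure_exists_sum_ge_le P (n := n) N
    (fun v z => lam * (⟪w z, v⟫ ^ 2 * absInd (τ / 2) (o z))) hmeas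
    (m := fun _ => 12 * (σ / τ) ^ 2) (L := 2 * p) t (hcard.trans (six_pow_le_exp p)) ?_)
  · intro x hx
    by_contra hc
    apply hx
    simp only [mem_ofPred_eq, not_exists, not_and, not_le] at hc
    set q : Vec p → ℝ := fun v => (1 / n : ℝ) * ∑ i, ⟪w (x i), v⟫ ^ 2 * absInd (τ / 2) (o (x i))
    have hqN : ∀ v ∈ N, q v ≤ (12 / c₁ ^ 2 + 2) / lam * ζ ^ 2 := by
      intro v hv
      have h1 := hc v hv
      rw [← Finset.mul_sum] at h1
      simp only [q]
      set S := ∑ i, ⟪w (x i), v⟫ ^ 2 * absInd (τ / 2) (o (x i))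
      have h2 : (σ / τ) ^ 2 ≤ ζ ^ 2 / c₁ ^ 2 := by
        rw [← div_pow]
        have := M.σ_pos
        gcongr
      have h3 : lam * S ≤ n * ((12 / c₁ ^ 2 + 2) * ζ ^ 2) := by
        have h4 : n * (12 * (σ / τ) ^ 2) ≤ n * (12 * (ζ ^ 2 / c₁ ^ 2)) := by gcongr
        have h5 : 12 * (ζ ^ 2 / c₁ ^ 2) = 12 / c₁ ^ 2 * ζ ^ 2 := by ring
        rw [h5] at h4
        nlinarith
      rw [one_div, inv_mul_le_iff₀ hn', div_mul_eq_mul_div, mul_div_assoc', le_div_iff₀ hl]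
      linarith
    have hqb : ∀ v : Vec p, ‖v‖ ≤ 1 → q v ≤ (1 / n : ℝ) * ∑ i, ‖w (x i)‖ ^ 2 := by
      intro v hv
      simp only [q]
      gcongr with i
      have h1 : |⟪w (x i), v⟫| ≤ ‖w (x i)‖ :=
        (abs_real_inner_le_norm _ _).trans (mul_le_of_le_one_right (norm_nonneg _) hv)
      have h2 : ⟪w (x i), v⟫ ^ 2 ≤ ‖w (x i)‖ ^ 2 := by
        rw [← sq_abs]
        gcongr
      have h3 : absInd (τ / 2) (o (x i)) ≤ 1 := by unfold absInd; split_ifs <;> norm_num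
      exact (mul_le_of_le_one_right (sq_nonneg _) h3).trans h2
    intro v hv
    have := quadratic_le_four_mul_of_net hnet q ?_ ?_ hqb hqN v hv
    · refine this.trans (le_of_eq ?_)
      ring
    · intro u v
      simp only [q]
      have hsum : ∀ a b : Fin n → ℝ, 2 * ((1 / n : ℝ) * ∑ i, a i) + 2 * ((1 / n : ℝ) * ∑ i, b i) =
          (1 / n : ℝ) * ∑ i, (2 * a i + 2 * b i) := by
        intro a b
        rw [Finset.sum_add_distrib, ← Finset.mul_sum, ← Finset.mul_sum]
        ring
      rw [hsum]
      gcongr with i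
      rw [inner_add_right]
      have := absInd_nonneg (τ / 2) (o (x i))
      nlinarith [mul_nonneg this (sq_nonneg (⟪w (x i), u⟫ - ⟪w (x i), v⟫))]
    · intro r v
      simp only [q, inner_smul_right, mul_pow, mul_assoc, ← Finset.mul_sum]
      ring
  · intro v hv
    have hv1 := hball v hv
    have hmv := M.measurable_inner v
    have hpt : ∀ z, Real.exp (lam * (⟪w z, v⟫ ^ 2 * absInd (τ / 2) (o z))) ≤
        1 + 4 / τ ^ 2 * (Real.exp (lam * ⟪w z, v⟫ ^ 2) * o z ^ 2) := by
      intro z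
      unfold absInd
      split_ifs with h
      · rw [mul_one]
        have h1 : 1 ≤ 4 / τ ^ 2 * o z ^ 2 := by
          rw [div_mul_eq_mul_div, le_div_iff₀ (by positivity), ← sq_abs (o z)]
          nlinarith
        nlinarith [Real.exp_pos (lam * ⟪w z, v⟫ ^ 2)]
      · simp only [mul_zero, Real.exp_zero]
        have : 0 ≤ 4 / τ ^ 2 * (Real.exp (lam * ⟪w z, v⟫ ^ 2) * o z ^ 2) := by positivity
        linarith
    calc ∫⁻ z, ENNReal.ofReal (Real.exp (lam * (⟪w z, v⟫ ^ 2 * absInd (τ / 2) (o z)))) ∂P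
        ≤ ∫⁻ z, (1 + ENNReal.ofReal (4 / τ ^ 2) *
            ENNReal.ofReal (Real.exp (lam * ⟪w z, v⟫ ^ 2) * o z ^ 2)) ∂P := by
          refine lintegral_mono fun z => (ENNReal.ofReal_le_ofReal (hpt z)).trans ?_
          rw [ENNReal.ofReal_add (by norm_num) (by positivity), ENNReal.ofReal_one,
            ENNReal.ofReal_mul (by positivity)]
      _ = 1 + ENNReal.ofReal (4 / τ ^ 2) *
            ∫⁻ z, ENNReal.ofReal (Real.exp (lam * ⟪w z, v⟫ ^ 2) * o z ^ 2) ∂P := by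
          rw [lintegral_add_left measurable_const, lintegral_const_mul _ (by fun_prop)]
          simp
      _ ≤ 1 + ENNReal.ofReal (4 / τ ^ 2) * (ENNReal.ofReal (σ ^ 2) * ENNReal.ofReal 3) := by
          gcongr
          have hcont : Measurable fun y : Vec p => Real.exp (lam * ⟪y, v⟫ ^ 2) := by fun_prop
          refine (M.lintegral_mul_sq_le _ hcont (fun y => (Real.exp_pos _).le)).trans ?_
          gcongr
          exact M.lintegral_exp_sq v hv1
      _ = ENNReal.ofReal (1 + 12 * (σ / τ) ^ 2) := by
          rw [← ENNReal.ofReal_mul (by positivity), ← ENNReal.ofReal_mul (by positivity),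
            ← ENNReal.ofReal_one, ← ENNReal.ofReal_add (by norm_num) (by positivity)]
          congr 1
          field_simp
          ring
      _ ≤ ENNReal.ofReal (Real.exp (12 * (σ / τ) ^ 2)) := by
          apply ENNReal.ofReal_le_ofReal
          linarith [Real.add_one_le_exp (12 * (σ / τ) ^ 2)]

/-- Uniform control of the large values of linear functionals. The truncation level `T ≍ 1 / ζ` makes
the exponential moment of the truncated square close to one, which pays for a net of resolution `ζ`. -/
lemma measure_tail_truncation_le (M : StandardizedModel P w e o α lam f σ) {n : ℕ} (hn : 0 < n)
    {t ζ T : ℝ} (ht : 0 < t) (hζ : 0 < ζ) (hζ1 : ζ ≤ 1) (hnζ : n * ζ ^ 2 = p + t) (hT0 : 0 < T)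
    (hT : 1 ≤ lam / 2 * T ^ 2 * ζ) :
    (Measure.pi fun _ : Fin n => P) {x | ¬ ((∀ v : Vec p, ‖v‖ ≤ 1 →
        (1 / n : ℝ) * ∑ i, ⟪w (x i), v⟫ ^ 2 ≤ 2) → ∀ v : Vec p, ‖v‖ ≤ 1 →
          (1 / n : ℝ) * ∑ i, sqTail (2 * T) ⟪w (x i), v⟫ ≤ (96 / lam + 16) * ζ)} ≤
      ENNReal.ofReal (Real.exp (-t)) := by
  have hl := M.lam_pos
  have hn' : (0 : ℝ) < n := by exact_mod_cast hn
  obtain ⟨N, hcard, hball, hnet⟩ := exists_finset_net (E := Vec p) hζ hζ1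
  rw [finrank_euclideanSpace_fin] at hcard
  refine le_trans (measure_mono ?_) (measure_exists_sum_ge_le P (n := n) N
    (fun v z => lam / 2 * max (|⟪w z, v⟫| - T) 0 ^ 2)
    (fun v => by have := M.measurable_inner v; fun_prop)
    (m := fun _ => 3 * ζ) (L := p * (3 / ζ)) t ?_ ?_)
  · intro x hx
    by_contra hc
    apply hx
    simp only [mem_ofPred_eq, not_exists, not_and, not_le] at hc
    intro hgram v hv
    obtain ⟨v', hv', hd⟩ := hnet v hv
    have h1 := hc v' hv'
    rw [← Finset.mul_sum] at h1
    set S := ∑ i, max (|⟪w (x i), v'⟫| - T) 0 ^ 2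
    have hS : (1 / n : ℝ) * S ≤ 12 / lam * ζ := by
      have h2 : p * (3 / ζ) + t ≤ 3 * n * ζ := by
        have : 3 * n * ζ = (p + t) * (3 / ζ) := by
          rw [← hnζ]
          field_simp
        rw [this, add_mul]
        have : 1 ≤ 3 / ζ := by rw [le_div_iff₀ hζ]; linarith
        nlinarith
      have h3 : lam / 2 * S ≤ n * (6 * ζ) := by linarith
      rw [one_div, inv_mul_le_iff₀ hn', div_mul_eq_mul_div, mul_div_assoc', le_div_iff₀ hl]
      linarith
    have hD : (1 / n : ℝ) * ∑ i, ⟪w (x i), v - v'⟫ ^ 2 ≤ 2 * ζ ^ 2 := by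
      have h2 := hgram (ζ⁻¹ • (v - v')) (by
        rw [norm_smul, norm_inv, Real.norm_of_nonneg hζ.le, inv_mul_le_iff₀ hζ]
        linarith)
      simp only [inner_smul_right, mul_pow, ← Finset.mul_sum] at h2
      rw [mul_left_comm, inv_pow, inv_mul_le_iff₀ (by positivity)] at h2
      linarith
    have hpt : ∀ i, sqTail (2 * T) ⟪w (x i), v⟫ ≤
        8 * max (|⟪w (x i), v'⟫| - T) 0 ^ 2 + 8 * ⟪w (x i), v - v'⟫ ^ 2 := by
      intro i
      unfold sqTail
      split_ifs with h
      · have h2 : |⟪w (x i), v⟫| ≤ |⟪w (x i), v'⟫| + |⟪w (x i), v - v'⟫| := by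
          rw [inner_sub_right]
          have := abs_add_le ⟪w (x i), v'⟫ (⟪w (x i), v⟫ - ⟪w (x i), v'⟫)
          rwa [add_sub_cancel] at this
        have h3 := le_max_left (|⟪w (x i), v'⟫| - T) 0
        set a := max (|⟪w (x i), v'⟫| - T) 0
        have h4 : |⟪w (x i), v⟫| ≤ 2 * (a + |⟪w (x i), v - v'⟫|) := by linarith
        rw [← sq_abs ⟪w (x i), v⟫, ← sq_abs ⟪w (x i), v - v'⟫]
        calc |⟪w (x i), v⟫| ^ 2 ≤ (2 * (a + |⟪w (x i), v - v'⟫|)) ^ 2 := by gcongr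
          _ ≤ _ := by nlinarith [sq_nonneg (a - |⟪w (x i), v - v'⟫|)]
      · positivity
    calc (1 / n : ℝ) * ∑ i, sqTail (2 * T) ⟪w (x i), v⟫
        ≤ (1 / n : ℝ) * ∑ i, (8 * max (|⟪w (x i), v'⟫| - T) 0 ^ 2
            + 8 * ⟪w (x i), v - v'⟫ ^ 2) := by
          gcongr with i
          exact hpt i
      _ = 8 * ((1 / n : ℝ) * S) + 8 * ((1 / n : ℝ) * ∑ i, ⟪w (x i), v - v'⟫ ^ 2) := by
          rw [Finset.sum_add_distrib, ← Finset.mul_sum, ← Finset.mul_sum]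
          ring
      _ ≤ 8 * (12 / lam * ζ) + 8 * (2 * ζ ^ 2) := by gcongr
      _ ≤ (96 / lam + 16) * ζ := by
          have : 8 * (12 / lam * ζ) = 96 / lam * ζ := by ring
          rw [this]
          nlinarith
  · refine hcard.trans ?_
    rw [Real.exp_nat_mul]
    gcongr
    linarith [Real.add_one_le_exp (3 / ζ)]
  · intro v hv
    have hv1 := hball v hv
    have hmv := M.measurable_inner v
    have hpt : ∀ z, Real.exp (lam / 2 * max (|⟪w z, v⟫| - T) 0 ^ 2) ≤
        1 + Real.exp (-(lam / 2 * T ^ 2)) * Real.exp (lam * ⟪w z, v⟫ ^ 2) := by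
      intro z
      rcases le_total |⟪w z, v⟫| T with h | h
      · rw [max_eq_right (by linarith)]
        simp only [ne_eq, OfNat.ofNat_ne_zero, not_false_eq_true, zero_pow, mul_zero,
          Real.exp_zero]
        have := mul_pos (Real.exp_pos (-(lam / 2 * T ^ 2))) (Real.exp_pos (lam * ⟪w z, v⟫ ^ 2))
        linarith
      · rw [max_eq_left (by linarith), ← Real.exp_add]
        have : Real.exp (lam / 2 * (|⟪w z, v⟫| - T) ^ 2) ≤
            Real.exp (-(lam / 2 * T ^ 2) + lam * ⟪w z, v⟫ ^ 2) := by
          rw [Real.exp_le_exp, ← sq_abs ⟪w z, v⟫]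
          have h1 : (|⟪w z, v⟫| - T) ^ 2 ≤ |⟪w z, v⟫| ^ 2 := by
            have := abs_nonneg ⟪w z, v⟫
            gcongr
            linarith
          have h2 : T ^ 2 ≤ |⟪w z, v⟫| ^ 2 := by gcongr
          nlinarith
        linarith
    have hexp : Real.exp (-(lam / 2 * T ^ 2)) ≤ ζ := by
      rw [Real.exp_neg, inv_le_comm₀ (Real.exp_pos _) hζ]
      have h1 := Real.add_one_le_exp (lam / 2 * T ^ 2)
      have h2 : ζ⁻¹ ≤ lam / 2 * T ^ 2 := by
        rw [inv_eq_one_div, div_le_iff₀ hζ]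
        exact hT
      linarith
    calc ∫⁻ z, ENNReal.ofReal (Real.exp (lam / 2 * max (|⟪w z, v⟫| - T) 0 ^ 2)) ∂P
        ≤ ∫⁻ z, (1 + ENNReal.ofReal ζ * ENNReal.ofReal (Real.exp (lam * ⟪w z, v⟫ ^ 2))) ∂P := by
          refine lintegral_mono fun z => (ENNReal.ofReal_le_ofReal (hpt z)).trans ?_
          rw [ENNReal.ofReal_add (by norm_num) (by positivity), ENNReal.ofReal_one,
            ENNReal.ofReal_mul (by positivity)]
          gcongr
      _ = 1 + ENNReal.ofReal ζ * ∫⁻ z, ENNReal.ofReal (Real.exp (lam * ⟪w z, v⟫ ^ 2)) ∂P := by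
          rw [lintegral_add_left measurable_const, lintegral_const_mul _ (by fun_prop)]
          simp
      _ ≤ 1 + ENNReal.ofReal ζ * ENNReal.ofReal 3 := by
          gcongr
          exact M.lintegral_exp_sq v hv1
      _ = ENNReal.ofReal (1 + 3 * ζ) := by
          rw [← ENNReal.ofReal_mul hζ.le, ← ENNReal.ofReal_one,
            ← ENNReal.ofReal_add (by norm_num) (by positivity), mul_comm]
      _ ≤ ENNReal.ofReal (Real.exp (3 * ζ)) := by
          apply ENNReal.ofReal_le_ofReal
          linarith [Real.add_one_le_exp (3 * ζ)]

/-- The Huberized score at the true parameters. Truncation at `τ` costs a bias of at most `σ² / τ`. -/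
lemma measure_score_le (M : StandardizedModel P w e o α lam f σ) {n : ℕ} (hn : 0 < n)
    {t ζ c₁ c₂ τ : ℝ} (ht : 0 < t) (hζ : 0 < ζ) (hnζ : n * ζ ^ 2 = p + t)
    (hc₁ : 0 < c₁) (hc₂ : 0 < c₂) (hτ : 0 < τ) (hστ : σ / τ ≤ ζ / c₁) (hτσ : τ * ζ ≤ c₂ * σ) :
    (Measure.pi fun _ : Fin n => P) {x | ¬
      ‖(1 / n : ℝ) • ∑ i, huberScore τ (o (x i)) • w (x i)‖ ≤
        2 * (3 / (lam * c₁) + 18 / (1 + c₂) + 2 * (1 + c₂) / lam) * (σ * ζ)} ≤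
      ENNReal.ofReal (Real.exp (-t)) := by
  have hl := M.lam_pos
  have hl4 := M.lam_le
  have hσ := M.σ_pos
  have hn' : (0 : ℝ) < n := by exact_mod_cast hn
  obtain ⟨N, hcard, hball, hnet⟩ := exists_finset_net (E := Vec p) (ρ := 1 / 2) (by norm_num)
    (by norm_num)
  rw [finrank_euclideanSpace_fin] at hcard
  have hmo := M.measurable_o
  have hmψ : Measurable fun z => huberScore τ (o z) := (measurable_huberScore τ).comp hmo
  -- The exponent is as large as `s τ ≤ lam` permits.
  set s : ℝ := lam * ζ / (σ * (1 + c₂))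
  have hs : 0 < s := by positivity
  have hsτ : s * τ ≤ lam := by
    simp only [s]
    rw [div_mul_eq_mul_div, div_le_iff₀ (by positivity)]
    have : τ * ζ ≤ σ * (1 + c₂) := by nlinarith
    nlinarith
  have hpow : ∀ b : ℝ, |b| ≤ 1 / lam * Real.exp (lam * b ^ 2) := by
    intro b
    rw [div_mul_eq_mul_div, one_mul, le_div_iff₀ hl, ← sq_abs b]
    nlinarith [Real.add_one_le_exp (lam * |b| ^ 2), sq_nonneg (|b| - 1), abs_nonneg b]
  refine le_trans (measure_mono ?_) (measure_exists_sum_ge_le P (n := n) N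
    (fun v z => s * (huberScore τ (o z) * ⟪w z, v⟫))
    (fun v => (hmψ.mul (M.measurable_inner v)).const_mul s)
    (m := fun _ => s * (σ ^ 2 / τ * (3 / lam)) + s ^ 2 * (18 * σ ^ 2 / lam)) (L := 2 * p) t
    (hcard.trans (six_pow_le_exp p)) ?_)
  · intro x hx
    by_contra hc
    apply hx
    simp only [mem_ofPred_eq, not_exists, not_and, not_le] at hc
    refine (norm_le_two_mul_of_net hnet _
      (c := (3 / (lam * c₁) + 18 / (1 + c₂) + 2 * (1 + c₂) / lam) * (σ * ζ)) ?_).trans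
      (le_of_eq (by ring))
    intro v hv
    have h1 := hc v hv
    rw [← Finset.mul_sum] at h1
    have h2 : ⟪(1 / n : ℝ) • ∑ i, huberScore τ (o (x i)) • w (x i), v⟫ =
        (1 / n : ℝ) * ∑ i, huberScore τ (o (x i)) * ⟪w (x i), v⟫ := by
      simp [inner_smul_left, sum_inner]
    rw [h2]
    set S := ∑ i, huberScore τ (o (x i)) * ⟪w (x i), v⟫
    rw [one_div, inv_mul_le_iff₀ hn']
    have h3 : σ ^ 2 / τ * (3 / lam) ≤ 3 / (lam * c₁) * (σ * ζ) := by
      calc σ ^ 2 / τ * (3 / lam) = σ / τ * (3 * σ / lam) := by ring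
        _ ≤ ζ / c₁ * (3 * σ / lam) := by gcongr
        _ = _ := by field_simp
    have h4 : s ^ 2 * (18 * σ ^ 2 / lam) = s * (18 / (1 + c₂) * (σ * ζ)) := by
      simp only [s]
      field_simp
    have h5 : 2 * ζ ^ 2 = s * (2 * (1 + c₂) / lam * (σ * ζ)) := by
      simp only [s]
      field_simp
    have h6 : s * S ≤ s * (n * ((3 / (lam * c₁) + 18 / (1 + c₂) + 2 * (1 + c₂) / lam) * (σ * ζ))) := by
      have h7 : n * (s * (σ ^ 2 / τ * (3 / lam))) ≤ n * (s * (3 / (lam * c₁) * (σ * ζ))) := by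
        gcongr
      have h8 : 2 * (p : ℝ) + t ≤ n * (2 * ζ ^ 2) := by linarith
      rw [h5] at h8
      rw [h4] at h1
      nlinarith
    exact le_of_mul_le_mul_left h6 hs
  · intro v hv
    have hv1 := hball v hv
    have hmv := M.measurable_inner v
    have hsqw : ∀ h : ℝ → ℝ, Measurable h → (∀ b, 0 ≤ h b) → ∀ C : ℝ, 0 ≤ C →
        (∀ b, h b ≤ C * Real.exp (lam * b ^ 2)) →
        ∫⁻ z, ENNReal.ofReal (h ⟪w z, v⟫ * o z ^ 2) ∂P ≤ ENNReal.ofReal (σ ^ 2 * (3 * C)) := by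
      intro h hm h0 C hC hle
      have hmh : Measurable fun y : Vec p => h ⟪y, v⟫ := hm.comp (by fun_prop)
      refine (M.lintegral_mul_sq_le (fun y => h ⟪y, v⟫) hmh fun y => h0 _).trans ?_
      rw [ENNReal.ofReal_mul (sq_nonneg σ)]
      gcongr
      refine M.lintegral_le_of_le_exp hv1 hv1 hC fun z => ?_
      rw [add_self_div_two]
      exact hle _
    have hnn : 0 ≤ σ ^ 2 / τ * (3 / lam) := by positivity
    -- `E ψ_τ(o) wᵀv = E (ψ_τ(o) - o) wᵀv`, and `|ψ_τ(o) - o| ≤ o² / τ`.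
    have hψint : Integrable (fun z => huberScore τ (o z) * ⟪w z, v⟫) P := by
      refine (M.integrable_of_abs_le_exp hv1 hv1 (hmψ.mul hmv) (C := τ / lam) (by positivity)
        fun z => ?_).1
      rw [add_self_div_two]
      change |huberScore τ (o z) * ⟪w z, v⟫| ≤ _
      rw [abs_mul]
      calc |huberScore τ (o z)| * |⟪w z, v⟫| ≤ τ * (1 / lam * Real.exp (lam * ⟪w z, v⟫ ^ 2)) :=
            mul_le_mul (abs_huberScore_le hτ.le _) (hpow _) (abs_nonneg _) hτ.le
        _ = _ := by ring
    have hdif : ∀ z, |huberScore τ (o z) * ⟪w z, v⟫ - o z * ⟪w z, v⟫| ≤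
        1 / τ * (|⟪w z, v⟫| * o z ^ 2) := by
      intro z
      rw [← sub_mul, abs_mul]
      calc _ ≤ o z ^ 2 / τ * |⟪w z, v⟫| := by
            gcongr
            exact abs_huberScore_sub_self_le hτ _
        _ = _ := by ring
    have hdl : ∫⁻ z, ENNReal.ofReal (|huberScore τ (o z) * ⟪w z, v⟫ - o z * ⟪w z, v⟫|) ∂P ≤
        ENNReal.ofReal (σ ^ 2 / τ * (3 / lam)) := by
      calc _ ≤ ∫⁻ z, ENNReal.ofReal (1 / τ) * ENNReal.ofReal (|⟪w z, v⟫| * o z ^ 2) ∂P := by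
            refine lintegral_mono fun z => ?_
            rw [← ENNReal.ofReal_mul (by positivity)]
            exact ENNReal.ofReal_le_ofReal (hdif z)
        _ = ENNReal.ofReal (1 / τ) * ∫⁻ z, ENNReal.ofReal (|⟪w z, v⟫| * o z ^ 2) ∂P :=
            lintegral_const_mul _ (by fun_prop)
        _ ≤ ENNReal.ofReal (1 / τ) * ENNReal.ofReal (σ ^ 2 * (3 * (1 / lam))) := by
            gcongr
            exact hsqw (fun b => |b|) measurable_id.abs (fun b => abs_nonneg b) (1 / lam)
              (by positivity) hpow
        _ = _ := by
            rw [← ENNReal.ofReal_mul (by positivity)]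
            congr 1
            ring
    have hdm : Measurable fun z => huberScore τ (o z) * ⟪w z, v⟫ - o z * ⟪w z, v⟫ := by fun_prop
    have hdint : Integrable (fun z => huberScore τ (o z) * ⟪w z, v⟫ - o z * ⟪w z, v⟫) P := by
      refine ⟨hdm.aestronglyMeasurable, ?_⟩
      rw [hasFiniteIntegral_iff_norm]
      exact hdl.trans_lt ENNReal.ofReal_lt_top
    have hoint : Integrable (fun z => o z * ⟪w z, v⟫) P :=
      (hψint.sub hdint).congr (Filter.Eventually.of_forall fun z => by simp)
    have hmean : ∫ z, huberScore τ (o z) * ⟪w z, v⟫ ∂P ≤ σ ^ 2 / τ * (3 / lam) := by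
      have h1 : ∫ z, (huberScore τ (o z) * ⟪w z, v⟫ - o z * ⟪w z, v⟫) ∂P =
          ∫ z, huberScore τ (o z) * ⟪w z, v⟫ ∂P := by
        rw [integral_sub hψint hoint, M.integral_mul_inner, sub_zero]
      rw [← h1]
      refine (le_abs_self _).trans ((abs_integral_le_integral_abs).trans ?_)
      rw [integral_eq_lintegral_of_nonneg_ae (Filter.Eventually.of_forall fun z => abs_nonneg _)
        hdm.abs.aestronglyMeasurable]
      exact ENNReal.toReal_le_of_le_ofReal hnn hdl
    refine lintegral_exp_mul_le P hψint hs.le (by positivity) hmean ?_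
    have hpt : ∀ z, (huberScore τ (o z) * ⟪w z, v⟫) ^ 2 *
        Real.exp (s * |huberScore τ (o z) * ⟪w z, v⟫|) ≤
        ⟪w z, v⟫ ^ 2 * Real.exp (lam * |⟪w z, v⟫|) * o z ^ 2 := by
      intro z
      rw [mul_pow, abs_mul]
      have h1 : huberScore τ (o z) ^ 2 ≤ o z ^ 2 :=
        sq_le_sq.2 (abs_huberScore_le_abs hτ.le _)
      have h2 : s * (|huberScore τ (o z)| * |⟪w z, v⟫|) ≤ lam * |⟪w z, v⟫| := by
        rw [← mul_assoc]
        gcongr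
        calc s * |huberScore τ (o z)| ≤ s * τ := by
              gcongr
              exact abs_huberScore_le hτ.le _
          _ ≤ lam := hsτ
      calc _ ≤ o z ^ 2 * ⟪w z, v⟫ ^ 2 * Real.exp (lam * |⟪w z, v⟫|) := by gcongr
        _ = _ := by ring
    refine (lintegral_mono fun z => ENNReal.ofReal_le_ofReal (hpt z)).trans ?_
    refine (hsqw (fun b => b ^ 2 * Real.exp (lam * |b|)) (by fun_prop) (fun b => by positivity)
      (6 / lam) (by positivity) ?_).trans (le_of_eq ?_)
    · intro b
      have h1 : b ^ 2 ≤ 2 / lam * Real.exp (lam / 2 * b ^ 2) := by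
        rw [div_mul_eq_mul_div, le_div_iff₀ hl]
        linarith [Real.add_one_le_exp (lam / 2 * b ^ 2)]
      have h2 : Real.exp (lam * |b|) ≤ 3 * Real.exp (lam / 2 * b ^ 2) := by
        have h3 : lam * |b| ≤ 1 + lam / 2 * b ^ 2 := by
          rw [← sq_abs b]
          nlinarith [sq_nonneg (|b| - 1)]
        calc Real.exp (lam * |b|) ≤ Real.exp (1 + lam / 2 * b ^ 2) := Real.exp_le_exp.2 h3
          _ = Real.exp 1 * Real.exp (lam / 2 * b ^ 2) := Real.exp_add _ _
          _ ≤ _ := by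
            gcongr
            linarith [Real.exp_one_lt_d9]
      calc b ^ 2 * Real.exp (lam * |b|)
          ≤ 2 / lam * Real.exp (lam / 2 * b ^ 2) * (3 * Real.exp (lam / 2 * b ^ 2)) := by gcongr
        _ = 6 / lam * (Real.exp (lam / 2 * b ^ 2) * Real.exp (lam / 2 * b ^ 2)) := by ring
        _ = 6 / lam * Real.exp (lam * b ^ 2) := by
            rw [← Real.exp_add]
            congr 2
            ring
    · congr 1
      ring

end StandardizedModel

lemma sum_abs_mul_abs_le_of_gram {E : Type*} [NormedAddCommGroup E] [InnerProductSpace ℝ E] {n : ℕ}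
    (w : Fin n → E) (hgram : ∀ v : E, ‖v‖ ≤ 1 → (1 / n : ℝ) * ∑ i, ⟪w i, v⟫ ^ 2 ≤ 2) {r : ℝ}
    (hr : 0 < r) {a b : E} (ha : ‖a‖ ≤ r) (hb : ‖b‖ ≤ 1) :
    (1 / n : ℝ) * ∑ i, |⟪w i, a⟫| * |⟪w i, b⟫| ≤ 2 * r := by
  have h1 := hgram (r⁻¹ • a) (by
    rw [norm_smul, norm_inv, Real.norm_of_nonneg hr.le, inv_mul_le_iff₀ hr]
    linarith)
  have h2 := hgram b hb
  have hpt : ∀ i, |⟪w i, a⟫| * |⟪w i, b⟫| ≤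
      r / 2 * ⟪w i, r⁻¹ • a⟫ ^ 2 + r / 2 * ⟪w i, b⟫ ^ 2 := by
    intro i
    have h3 : ⟪w i, a⟫ = r * ⟪w i, r⁻¹ • a⟫ := by
      rw [inner_smul_right]
      field_simp
    rw [h3, abs_mul, abs_of_pos hr, ← sq_abs ⟪w i, r⁻¹ • a⟫, ← sq_abs ⟪w i, b⟫]
    nlinarith [mul_nonneg hr.le (sq_nonneg (|⟪w i, r⁻¹ • a⟫| - |⟪w i, b⟫|))]
  calc (1 / n : ℝ) * ∑ i, |⟪w i, a⟫| * |⟪w i, b⟫|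
      ≤ (1 / n : ℝ) * ∑ i, (r / 2 * ⟪w i, r⁻¹ • a⟫ ^ 2 + r / 2 * ⟪w i, b⟫ ^ 2) := by
        gcongr with i
        exact hpt i
    _ = r / 2 * ((1 / n : ℝ) * ∑ i, ⟪w i, r⁻¹ • a⟫ ^ 2) +
          r / 2 * ((1 / n : ℝ) * ∑ i, ⟪w i, b⟫ ^ 2) := by
        rw [Finset.sum_add_distrib, ← Finset.mul_sum, ← Finset.mul_sum]
        ring
    _ ≤ r / 2 * 2 + r / 2 * 2 := by gcongr
    _ = 2 * r := by ring

namespace StandardizedModel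

variable {p : ℕ} {Z : Type*} [MeasurableSpace Z] {P : Measure Z}
  {w : Z → Vec p} {e o : Z → ℝ} {α lam f σ : ℝ}

/-- The mean of the hinge increment is quadratic in the displacement. -/
lemma integral_hingeIncr_mul_inner_le (M : StandardizedModel P w e o α lam f σ) {r₀ : ℝ}
    {u v : Vec p} (hu : ‖u‖ ≤ 1) (hv : ‖v‖ ≤ 1) :
    ∫ z, hingeIncr α (e z) ⟪w z, r₀ • v⟫ * ⟪w z, u⟫ ∂P ≤ f * (r₀ ^ 2 * (6 / lam ^ 2)) := by
  refine (M.integral_hingeIncr_le (r₀ • v) u).trans (mul_le_mul_of_nonneg_left ?_ M.f_nonneg)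
  have h1 : ∀ z, ⟪w z, r₀ • v⟫ ^ 2 * |⟪w z, u⟫| = r₀ ^ 2 * (⟪w z, v⟫ ^ 2 * |⟪w z, u⟫|) := by
    intro z
    rw [inner_smul_right]
    ring
  simp only [h1]
  rw [integral_const_mul]
  exact mul_le_mul_of_nonneg_left (M.integrable_sq_mul_abs hu hv).2 (sq_nonneg _)

variable [IsProbabilityMeasure P]

/-- Uniform control of the effect of the first-stage error. A net of resolution `1 / n` in the
displacement `δ` suffices because the hinge increment is Lipschitz in `δ`; its entropy `p log n` is the
source of the logarithm. When `p log n + t > n` the trivial Lipschitz bound is already enough. -/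
lemma measure_firstStage_le (M : StandardizedModel P w e o α lam f σ) {n : ℕ} (hp : 0 < p)
    {t ξ r₀ : ℝ} (ht : 0 < t) (hlog : 1 ≤ Real.log n) (hn3 : 3 ≤ n) (hξ : 0 < ξ) (hξ1 : ξ ≤ 1)
    (hnξ : n * ξ ^ 2 = p * Real.log n + t ∨ ξ = 1) (hr₀ : 0 < r₀) :
    (Measure.pi fun _ : Fin n => P) {x | ¬ ((∀ v : Vec p, ‖v‖ ≤ 1 →
        (1 / n : ℝ) * ∑ i, ⟪w (x i), v⟫ ^ 2 ≤ 2) → ∀ δ : Vec p, ‖δ‖ ≤ r₀ → ∀ u : Vec p, ‖u‖ ≤ 1 →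
          (1 / n : ℝ) * ∑ i, hingeIncr α (e (x i)) ⟪w (x i), δ⟫ * ⟪w (x i), u⟫ ≤
            12 / lam ^ 2 * (f * r₀ ^ 2) + (40 / lam + 2) * (r₀ * ξ))} ≤
      ENNReal.ofReal (Real.exp (-t)) := by
  have hl := M.lam_pos
  have hf := M.f_nonneg
  have hn' : (0 : ℝ) < n := by exact_mod_cast (by omega : 0 < n)
  have hn3' : (3 : ℝ) ≤ n := by exact_mod_cast hn3
  have hp1 : (1 : ℝ) ≤ p := by exact_mod_cast hp
  rcases hnξ with hnξ | rfl
  swap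
  · rw [show {x : Fin n → Z | ¬ ((∀ v : Vec p, ‖v‖ ≤ 1 →
        (1 / n : ℝ) * ∑ i, ⟪w (x i), v⟫ ^ 2 ≤ 2) → ∀ δ : Vec p, ‖δ‖ ≤ r₀ → ∀ u : Vec p, ‖u‖ ≤ 1 →
          (1 / n : ℝ) * ∑ i, hingeIncr α (e (x i)) ⟪w (x i), δ⟫ * ⟪w (x i), u⟫ ≤
            12 / lam ^ 2 * (f * r₀ ^ 2) + (40 / lam + 2) * (r₀ * 1))} = ∅ from ?_]
    · simp
    rw [eq_empty_iff_forall_notMem]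
    intro x hx
    apply hx
    intro hgram δ hδ u hu
    have h1 := sum_abs_mul_abs_le_of_gram (fun i => w (x i)) hgram hr₀ hδ hu
    have h2 : (1 / n : ℝ) * ∑ i, hingeIncr α (e (x i)) ⟪w (x i), δ⟫ * ⟪w (x i), u⟫ ≤
        (1 / n : ℝ) * ∑ i, |⟪w (x i), δ⟫| * |⟪w (x i), u⟫| := by
      refine mul_le_mul_of_nonneg_left (Finset.sum_le_sum fun i _ => ?_) (by positivity)
      refine (le_abs_self _).trans ?_
      rw [abs_mul]
      exact mul_le_mul_of_nonneg_right
        (abs_hingeIncr_le M.alpha_nonneg M.alpha_le_one _ _) (abs_nonneg _)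
    have h3 : 0 ≤ 12 / lam ^ 2 * (f * r₀ ^ 2) := by positivity
    have h4 : 0 ≤ 40 / lam * r₀ := by positivity
    linarith
  obtain ⟨N₁, hcard₁, hball₁, hnet₁⟩ := exists_finset_net (E := Vec p) (ρ := 1 / n)
    (by positivity) (by rw [div_le_one hn']; linarith)
  obtain ⟨N₂, hcard₂, hball₂, hnet₂⟩ := exists_finset_net (E := Vec p) (ρ := 1 / 2) (by norm_num)
    (by norm_num)
  rw [finrank_euclideanSpace_fin] at hcard₁ hcard₂
  set s : ℝ := lam / 2 * ξ
  have hs : 0 < s := by positivity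
  have hsl : s ≤ lam / 2 := by simp only [s]; nlinarith
  have hmF : ∀ vu : Vec p × Vec p, Measurable fun z =>
      r₀⁻¹ * (hingeIncr α (e z) ⟪w z, r₀ • vu.1⟫ * ⟪w z, vu.2⟫) := fun vu =>
    ((M.measurable_hingeIncr _).mul (M.measurable_inner _)).const_mul _
  refine le_trans (measure_mono ?_) (measure_exists_sum_ge_le P (n := n) (N₁ ×ˢ N₂)
    (fun vu z => s * (r₀⁻¹ * (hingeIncr α (e z) ⟪w z, r₀ • vu.1⟫ * ⟪w z, vu.2⟫)))
    (fun vu => (hmF vu).const_mul s)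
    (m := fun _ => s * (6 / lam ^ 2 * (f * r₀)) + s ^ 2 * (24 / lam ^ 2))
    (L := p * (2 * Real.log n) + 2 * p) t ?_ ?_)
  · intro x hx
    by_contra hc
    apply hx
    simp only [mem_ofPred_eq, not_exists, not_and, not_le, Finset.mem_product, Prod.forall] at hc
    intro hgram δ hδ
    have hN : ∀ v ∈ N₁, ‖(1 / n : ℝ) • ∑ i, hingeIncr α (e (x i)) ⟪w (x i), r₀ • v⟫ • w (x i)‖ ≤
        2 * (r₀ * (6 / lam ^ 2 * (f * r₀) + 20 / lam * ξ)) := by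
      intro v hv
      refine norm_le_two_mul_of_net hnet₂ _ fun u hu => ?_
      have h1 := hc v u ⟨hv, hu⟩
      rw [← Finset.mul_sum, ← Finset.mul_sum] at h1
      have h2 : ⟪(1 / n : ℝ) • ∑ i, hingeIncr α (e (x i)) ⟪w (x i), r₀ • v⟫ • w (x i), u⟫ =
          (1 / n : ℝ) * ∑ i, hingeIncr α (e (x i)) ⟪w (x i), r₀ • v⟫ * ⟪w (x i), u⟫ := by
        simp [inner_smul_left, sum_inner]
      rw [h2]
      set S := ∑ i, hingeIncr α (e (x i)) ⟪w (x i), r₀ • v⟫ * ⟪w (x i), u⟫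
      rw [one_div, inv_mul_le_iff₀ hn']
      have h3 : s ^ 2 * (24 / lam ^ 2) = s * (12 / lam * ξ) := by
        simp only [s]
        field_simp
        ring
      have h4 : 4 * ξ ^ 2 = s * (8 / lam * ξ) := by
        simp only [s]
        field_simp
        ring
      have h5 : p * (2 * Real.log n) + 2 * p + t ≤ n * (4 * ξ ^ 2) := by nlinarith
      rw [h4] at h5
      rw [h3] at h1
      have h6 : s * (r₀⁻¹ * S) ≤ s * (n * (6 / lam ^ 2 * (f * r₀) + 20 / lam * ξ)) := by
        have h7 : 20 / lam * ξ = 12 / lam * ξ + 8 / lam * ξ := by ring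
        rw [h7]
        nlinarith
      have h8 := le_of_mul_le_mul_left h6 hs
      rw [inv_mul_le_iff₀ hr₀] at h8
      linarith
    intro u hu
    obtain ⟨v, hv, hd⟩ := hnet₁ (r₀⁻¹ • δ) (by
      rw [norm_smul, norm_inv, Real.norm_of_nonneg hr₀.le, inv_mul_le_iff₀ hr₀]
      linarith)
    have hδv : ‖δ - r₀ • v‖ ≤ r₀ * (1 / n) := by
      have h1 : δ - r₀ • v = r₀ • (r₀⁻¹ • δ - v) := by
        rw [smul_sub, smul_smul, mul_inv_cancel₀ hr₀.ne', one_smul]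
      rw [h1, norm_smul, Real.norm_of_nonneg hr₀.le]
      gcongr
    have h1 := sum_abs_mul_abs_le_of_gram (fun i => w (x i)) hgram (by positivity) hδv hu
    have h2 : (1 / n : ℝ) * ∑ i, hingeIncr α (e (x i)) ⟪w (x i), r₀ • v⟫ * ⟪w (x i), u⟫ ≤
        2 * (r₀ * (6 / lam ^ 2 * (f * r₀) + 20 / lam * ξ)) := by
      have h3 := (real_inner_le_norm
        ((1 / n : ℝ) • ∑ i, hingeIncr α (e (x i)) ⟪w (x i), r₀ • v⟫ • w (x i)) u).trans
        (mul_le_of_le_one_right (norm_nonneg _) hu)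
      refine le_trans (le_of_eq ?_) (h3.trans (hN v hv))
      simp [inner_smul_left, sum_inner]
    have h3 : (1 / n : ℝ) * ∑ i, hingeIncr α (e (x i)) ⟪w (x i), δ⟫ * ⟪w (x i), u⟫ ≤
        (1 / n : ℝ) * ∑ i, (hingeIncr α (e (x i)) ⟪w (x i), r₀ • v⟫ * ⟪w (x i), u⟫ +
          |⟪w (x i), δ - r₀ • v⟫| * |⟪w (x i), u⟫|) := by
      gcongr with i
      have h4 := abs_hingeIncr_sub_le M.alpha_nonneg M.alpha_le_one (e (x i)) ⟪w (x i), δ⟫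
        ⟪w (x i), r₀ • v⟫
      rw [← inner_sub_right] at h4
      have h5 := mul_le_mul_of_nonneg_right h4 (abs_nonneg ⟪w (x i), u⟫)
      rw [← abs_mul, sub_mul] at h5
      linarith [le_abs_self (hingeIncr α (e (x i)) ⟪w (x i), δ⟫ * ⟪w (x i), u⟫ -
        hingeIncr α (e (x i)) ⟪w (x i), r₀ • v⟫ * ⟪w (x i), u⟫)]
    rw [Finset.sum_add_distrib, mul_add] at h3
    have h6 : 1 / (n : ℝ) ≤ ξ := by
      rw [div_le_iff₀ hn']
      by_contra hcon
      rw [not_le] at hcon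
      nlinarith
    have h7 : 2 * (r₀ * (1 / n)) ≤ 2 * (r₀ * ξ) := by gcongr
    have h8 : 2 * (r₀ * (6 / lam ^ 2 * (f * r₀) + 20 / lam * ξ)) =
        12 / lam ^ 2 * (f * r₀ ^ 2) + 40 / lam * (r₀ * ξ) := by ring
    linarith
  · rw [Finset.card_product]
    push_cast
    have h1 : (N₁.card : ℝ) ≤ Real.exp (p * (2 * Real.log n)) := by
      refine hcard₁.trans ?_
      rw [Real.exp_nat_mul]
      have h2 : Real.exp (2 * Real.log n) = (n : ℝ) ^ 2 := by
        have := Real.exp_nat_mul (Real.log n) 2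
        rw [Real.exp_log hn'] at this
        exact_mod_cast this
      rw [h2]
      gcongr
      rw [div_div_eq_mul_div, div_one]
      nlinarith
    have h2 := hcard₂.trans (six_pow_le_exp p)
    rw [Real.exp_add]
    gcongr
  · rintro ⟨v, u⟩ hvu
    rw [Finset.mem_product] at hvu
    have hv := hball₁ v hvu.1
    have hu := hball₂ u hvu.2
    have hF : ∀ z, |r₀⁻¹ * (hingeIncr α (e z) ⟪w z, r₀ • v⟫ * ⟪w z, u⟫)| ≤
        |⟪w z, v⟫| * |⟪w z, u⟫| := by
      intro z
      rw [abs_mul, abs_mul, abs_of_pos (inv_pos.2 hr₀), inv_mul_le_iff₀ hr₀, ← mul_assoc]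
      gcongr
      refine (abs_hingeIncr_le M.alpha_nonneg M.alpha_le_one _ _).trans ?_
      rw [inner_smul_right, abs_mul, abs_of_pos hr₀]
    have hint := (M.integrable_of_abs_le_exp hv hu (hmF (v, u)) (C := 1 / lam) (by positivity)
      (fun z => (hF z).trans (M.abs_mul_abs_le_exp _ _))).1
    refine lintegral_exp_mul_le P hint hs.le (by positivity) ?_
      (M.lintegral_sq_mul_exp_le hv hu hF hsl)
    rw [integral_const_mul, inv_mul_le_iff₀ hr₀]
    refine (M.integral_hingeIncr_mul_inner_le hu hv).trans (le_of_eq ?_)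
    ring

end StandardizedModel

/-! ### The Bahadur representation in standardized coordinates -/

set_option maxHeartbeats 600000 in
/-- Bahadur representation in standardized coordinates. The localization radius is `r₁ = K B`, where
`B = σ ζ + f r₀² + r₀ ξ` with `ζ² = (p + t) / n` and `ξ² = min ((p log n + t) / n) 1`; for a suitable
`K` it exceeds the linearization error plus the norm of the score. Letting the logarithmic first-stage
error enter `r₁` is harmless, since `r₁` enters the linearization error only through `ζ r₁`. -/
theorem standardized_bahadur {lam a b c₁ c₂ : ℝ} (hl : 0 < lam) (ha : 0 < a) (hb : 0 < b)
    (hc₁ : 0 < c₁) (hc₂ : 0 < c₂) : ∃ C C₀ : ℝ, 0 < C ∧ 0 < C₀ ∧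
    ∀ (n p : ℕ) (_ : 0 < p) (Z : Type) (_ : MeasurableSpace Z) (P : Measure Z)
      (_ : IsProbabilityMeasure P) (w : Z → Vec p) (e o : Z → ℝ) (α f σ : ℝ)
      (_ : StandardizedModel P w e o α lam f σ)
      (t : ℝ) (_ : 0 < t) (r₀ : ℝ) (_ : 0 < r₀) (_ : r₀ ≤ a * σ)
      (_ : f * r₀ ^ 2 ≤ b * (σ * √((p + t) / n)))
      (τ : ℝ) (_ : c₁ * (σ * √(n / (p + t))) ≤ τ) (_ : τ ≤ c₂ * (σ * √(n / (p + t))))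
      (_ : C₀ * (p + t) ≤ n),
    (Measure.pi fun _ : Fin n => P) {x | ¬ ∀ δ : Vec p, ‖δ‖ ≤ r₀ → ∀ h : Vec p,
      (∀ η : Vec p, ∑ i, huberLoss τ (⟪w (x i), h⟫ -
          (o (x i) + hingeIncr α (e (x i)) ⟪w (x i), δ⟫)) ≤
        ∑ i, huberLoss τ (⟪w (x i), η⟫ - (o (x i) + hingeIncr α (e (x i)) ⟪w (x i), δ⟫))) →
      ‖h - (1 / n : ℝ) • ∑ i, huberScore τ (o (x i)) • w (x i)‖ ≤
        C * (σ * ((p + t) / n) + f * r₀ ^ 2 + r₀ * √((p * Real.log n + t) / n))} ≤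
      5 * ENNReal.ofReal (Real.exp (-t)) := by
  set k₂ : ℝ := 4 * (12 / c₁ ^ 2 + 2) / lam with hk₂
  set k₃ : ℝ := 96 / lam + 16 with hk₃
  set k : ℝ := 80 / lam + k₂ + 3 * k₃ with hk
  set k₄ : ℝ := 2 * (3 / (lam * c₁) + 18 / (1 + c₂) + 2 * (1 + c₂) / lam) with hk₄
  set k₅ : ℝ := 12 / lam ^ 2 + (40 / lam + 2) with hk₅
  set K : ℝ := 2 * (k + k₄ + k₅) + 1 with hK
  set K₂ : ℝ := a + K * (1 + b + a) with hK₂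
  set c : ℝ := c₁ / (4 * K₂) with hc
  have k₂0 : 0 < k₂ := by positivity
  have k₃0 : 0 < k₃ := by positivity
  have k0 : 0 < k := by positivity
  have k₄0 : 0 < k₄ := by positivity
  have k₅0 : 0 < k₅ := by positivity
  have K0 : 0 < K := by positivity
  have K₂0 : 0 < K₂ := by positivity
  have c0 : 0 < c := by positivity
  clear_value K₂ K k k₂ k₃ k₄ k₅ c
  -- `C₀` makes `ζ` so small that `k ζ ≤ 1 / 2` and that the truncation level `T = c / ζ`, chosen with
  -- `(r₀ + r₁) * 2 T ≤ τ / 2`, satisfies the requirement of the tail bound; the `3` gives `log n ≥ 1`.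
  refine ⟨k + k * K + k₅, 3 + (2 * k) ^ 2 + (2 / (lam * c ^ 2)) ^ 2, by positivity, by positivity, ?_⟩
  intro n p hp Z _ P _ w e o α f σ M t ht r₀ hr₀ hr₀a hfb τ hτ1 hτ2 hn
  have hσ := M.σ_pos
  have hf := M.f_nonneg
  have hp1 : (1 : ℝ) ≤ p := by exact_mod_cast hp
  have hpt : 0 < p + t := by positivity
  have hq1 : 0 ≤ (2 * k) ^ 2 := sq_nonneg _
  have hq2 : 0 ≤ (2 / (lam * c ^ 2)) ^ 2 := sq_nonneg _
  have hn3' : (3 : ℝ) ≤ n := by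
    refine le_trans ?_ hn
    calc (3 : ℝ) = 3 * 1 := by norm_num
      _ ≤ (3 + (2 * k) ^ 2 + (2 / (lam * c ^ 2)) ^ 2) * (p + t) := by
        gcongr <;> linarith
  have hn3 : 3 ≤ n := by exact_mod_cast hn3'
  have hn' : (0 : ℝ) < n := by linarith
  have hlog : 1 ≤ Real.log n := by
    rw [Real.le_log_iff_exp_le hn']
    linarith [Real.exp_one_lt_d9]
  set ζ : ℝ := √((p + t) / n) with hζdef
  have hζ2 : ζ ^ 2 = (p + t) / n := Real.sq_sqrt (by positivity)
  have hζ : 0 < ζ := Real.sqrt_pos.2 (by positivity)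
  have hnζ : n * ζ ^ 2 = p + t := by rw [hζ2]; field_simp
  have hζinv : √(n / (p + t)) = 1 / ζ := by
    rw [hζdef, one_div, ← Real.sqrt_inv, inv_div]
  have hC₀ζ : (3 + (2 * k) ^ 2 + (2 / (lam * c ^ 2)) ^ 2) * ζ ^ 2 ≤ 1 := by
    rw [hζ2, mul_div_assoc', div_le_one hn']
    exact hn
  have hsum : 3 * ζ ^ 2 + (2 * k * ζ) ^ 2 + (2 / (lam * c ^ 2) * ζ) ^ 2 ≤ 1 := by
    refine le_trans (le_of_eq ?_) hC₀ζ
    ring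
  have hs1 := sq_nonneg ζ
  have hs2 := sq_nonneg (2 * k * ζ)
  have hs3 := sq_nonneg (2 / (lam * c ^ 2) * ζ)
  have hζsq1 : ζ ^ 2 ≤ 1 := by linarith
  have hζ1 : ζ ≤ 1 := (sq_le_one_iff₀ hζ.le).1 hζsq1
  have hkζ : k * ζ ≤ 1 / 2 := by
    have : 2 * k * ζ ≤ 1 := (sq_le_one_iff₀ (by positivity)).1 (by linarith)
    linarith
  have hcζ : 1 ≤ lam / 2 * (c / ζ) ^ 2 * ζ := by
    have : 2 / (lam * c ^ 2) * ζ ≤ 1 := (sq_le_one_iff₀ (by positivity)).1 (by linarith)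
    rw [div_mul_eq_mul_div, div_le_one (by positivity)] at this
    have h1 : lam / 2 * (c / ζ) ^ 2 * ζ = lam * c ^ 2 / (2 * ζ) := by
      field_simp
    rw [h1, le_div_iff₀ (by positivity)]
    linarith
  clear_value ζ
  set ξ' : ℝ := √((p * Real.log n + t) / n) with hξ'def
  set ξ : ℝ := √(min ((p * Real.log n + t) / n) 1) with hξdef
  have hple : (p : ℝ) ≤ p * Real.log n := le_mul_of_one_le_right (by positivity) hlog
  have hζξ : ζ ≤ ξ := by
    rw [hζdef, hξdef]
    refine Real.sqrt_le_sqrt (le_min (by gcongr) ?_)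
    rwa [← hζ2]
  have hξ : 0 < ξ := hζ.trans_le hζξ
  have hξ1 : ξ ≤ 1 := Real.sqrt_le_one.2 (min_le_right _ _)
  have hξξ' : ξ ≤ ξ' := Real.sqrt_le_sqrt (min_le_left _ _)
  have hnξ : n * ξ ^ 2 = p * Real.log n + t ∨ ξ = 1 := by
    rcases le_total ((p * Real.log n + t) / n) 1 with h | h
    · left
      rw [hξdef, min_eq_left h, Real.sq_sqrt (by positivity)]
      field_simp
    · right
      rw [hξdef, min_eq_right h, Real.sqrt_one]
  clear_value ξ ξ'
  rw [hζinv] at hτ1 hτ2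
  have hτ : 0 < τ := lt_of_lt_of_le (by positivity) hτ1
  have hστ : σ / τ ≤ ζ / c₁ := by
    rw [div_le_div_iff₀ hτ hc₁]
    have : c₁ * (σ * (1 / ζ)) = c₁ * σ / ζ := by ring
    rw [this, div_le_iff₀ hζ] at hτ1
    linarith
  have hτσ : τ * ζ ≤ c₂ * σ := by
    have : c₂ * (σ * (1 / ζ)) = c₂ * σ / ζ := by ring
    rwa [this, le_div_iff₀ hζ] at hτ2
  set B : ℝ := σ * ζ + f * r₀ ^ 2 + r₀ * ξ with hB
  have hB0 : 0 < B := by positivity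
  set r₁ : ℝ := K * B with hr₁
  have hr₁0 : 0 < r₁ := by positivity
  clear_value B r₁
  set R : ℝ := 80 / lam * ζ * r₁ + (12 / lam ^ 2 * (f * r₀ ^ 2) + (40 / lam + 2) * (r₀ * ξ)) +
    (k₂ * ζ ^ 2 + 3 * (k₃ * ζ)) * (r₀ + r₁) with hR
  have hR0 : 0 ≤ R := by positivity
  clear_value R
  have hfr : 0 ≤ f * r₀ ^ 2 := by positivity
  have hκ₅ : 12 / lam ^ 2 * (f * r₀ ^ 2) + (40 / lam + 2) * (r₀ * ξ) ≤
      k₅ * (f * r₀ ^ 2 + r₀ * ξ) := by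
    have h1 : 0 ≤ 12 / lam ^ 2 * (r₀ * ξ) := by positivity
    have h2 : 0 ≤ (40 / lam + 2) * (f * r₀ ^ 2) := by positivity
    rw [hk₅]
    linarith
  have hRle : R ≤ k * ζ * (r₀ + r₁) + k₅ * (f * r₀ ^ 2 + r₀ * ξ) := by
    have h1 : k₂ * ζ ^ 2 ≤ k₂ * ζ := by
      gcongr
      exact pow_le_of_le_one hζ.le hζ1 two_ne_zero
    have h2 : (k₂ * ζ ^ 2 + 3 * (k₃ * ζ)) * (r₀ + r₁) ≤ (k₂ * ζ + 3 * (k₃ * ζ)) * (r₀ + r₁) := by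
      gcongr
    have h3 : 0 ≤ 80 / lam * ζ * r₀ := by positivity
    have h4 : k * ζ * (r₀ + r₁) = 80 / lam * ζ * r₀ + 80 / lam * ζ * r₁ +
        (k₂ * ζ + 3 * (k₃ * ζ)) * (r₀ + r₁) := by rw [hk]; ring
    rw [hR, h4]
    linarith
  have hlt : R + k₄ * (σ * ζ) < r₁ := by
    have hσζ := mul_pos hσ hζ
    have hrξ := mul_pos hr₀ hξ
    have h1 : k * ζ * r₀ ≤ k * B := by
      rw [mul_assoc]
      gcongr
      have : r₀ * ζ ≤ r₀ * ξ := by gcongr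
      rw [hB]
      linarith
    have h2 : k * ζ * r₁ ≤ 1 / 2 * r₁ := by gcongr
    have h3 : k₅ * (f * r₀ ^ 2 + r₀ * ξ) ≤ k₅ * B := by
      gcongr
      rw [hB]
      linarith
    have h4 : k₄ * (σ * ζ) ≤ k₄ * B := by
      gcongr
      rw [hB]
      linarith
    have h5 : r₁ = 2 * (k * B + k₄ * B + k₅ * B) + B := by rw [hr₁, hK]; ring
    linarith
  have hfin : R ≤ (k + k * K + k₅) * (σ * ((p + t) / n) + f * r₀ ^ 2 + r₀ * ξ') := by
    rw [← hζ2]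
    set D := σ * ζ ^ 2 + f * r₀ ^ 2 + r₀ * ξ' with hD
    have hξ'0 : 0 < ξ' := hξ.trans_le hξξ'
    have hσζ : 0 < σ * ζ ^ 2 := by positivity
    have h0 : r₀ * ξ ≤ r₀ * ξ' := by gcongr
    have h1 : ζ * r₀ ≤ D := by
      have : r₀ * ζ ≤ r₀ * ξ := by gcongr
      rw [hD]
      linarith
    have h2 : ζ * B ≤ D := by
      have e1 : ζ * (f * r₀ ^ 2) ≤ f * r₀ ^ 2 := mul_le_of_le_one_left hfr hζ1
      have e2 : ζ * (r₀ * ξ) ≤ r₀ * ξ := mul_le_of_le_one_left (by positivity) hζ1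
      have e3 : ζ * B = σ * ζ ^ 2 + ζ * (f * r₀ ^ 2) + ζ * (r₀ * ξ) := by rw [hB]; ring
      rw [e3, hD]
      linarith
    have h3 : f * r₀ ^ 2 + r₀ * ξ ≤ D := by rw [hD]; linarith
    calc R ≤ k * (ζ * r₀) + k * K * (ζ * B) + k₅ * (f * r₀ ^ 2 + r₀ * ξ) := by
          refine hRle.trans (le_of_eq ?_)
          rw [hr₁]
          ring
      _ ≤ k * D + k * K * D + k₅ * D := by gcongr
      _ = _ := by ring
  have hT : (r₀ + r₁) * (2 * (c / ζ)) ≤ τ / 2 := by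
    have h1 : r₀ + r₁ ≤ K₂ * σ := by
      have e1 : σ * ζ ≤ σ := mul_le_of_le_one_right hσ.le hζ1
      have e2 : f * r₀ ^ 2 ≤ b * σ := hfb.trans (by gcongr)
      have e3 : r₀ * ξ ≤ a * σ := (mul_le_of_le_one_right hr₀.le hξ1).trans hr₀a
      have e4 : B ≤ (1 + b + a) * σ := by rw [hB]; linarith
      have e5 : r₁ ≤ K * ((1 + b + a) * σ) := by rw [hr₁]; gcongr
      rw [hK₂]
      linarith
    calc (r₀ + r₁) * (2 * (c / ζ)) ≤ K₂ * σ * (2 * (c / ζ)) := by gcongr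
      _ = c₁ * (σ * (1 / ζ)) / 2 := by
          rw [hc]
          field_simp
          ring
      _ ≤ τ / 2 := by gcongr
  have hn0 : 0 < n := by omega
  refine le_trans (measure_mono (t := _ ∪ (_ ∪ (_ ∪ (_ ∪ _)))) ?_) (le_trans
    ((measure_union_le _ _).trans (add_le_add
      (M.measure_gram_le hn0 ht hζ hζ1 hnζ) ((measure_union_le _ _).trans (add_le_add
      (M.measure_noise_truncation_le hn0 ht hnζ hτ hστ) ((measure_union_le _ _).trans
      (add_le_add (M.measure_tail_truncation_le hn0 ht hζ hζ1 hnζ (T := c / ζ) (by positivity) hcζ)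
      ((measure_union_le _ _).trans (add_le_add
      (M.measure_score_le hn0 ht hζ hnζ hc₁ hc₂ hτ hστ hτσ)
      (M.measure_firstStage_le hp ht hlog hn3 hξ hξ1 hnξ hr₀))))))))) (le_of_eq (by ring)))
  intro x hx
  by_contra hgood
  simp only [mem_union, mem_ofPred_eq, not_or, not_not] at hgood
  obtain ⟨h₁, h₂, h₃, h₄, h₅⟩ := hgood
  rw [← hk₄] at h₄
  apply hx
  have hgram : ∀ v : Vec p, ‖v‖ ≤ 1 → (1 / n : ℝ) * ∑ i, ⟪w (x i), v⟫ ^ 2 ≤ 2 := by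
    intro v hv
    have h := (abs_le.1 (h₁ v v)).2
    rw [real_inner_self_eq_norm_sq] at h
    simp only [← pow_two] at h
    have h80 : 80 / lam * ζ ≤ 1 / 2 := by
      refine le_trans ?_ hkζ
      gcongr
      rw [hk]
      linarith
    have hv2 : ‖v‖ ^ 2 ≤ 1 := pow_le_one₀ (norm_nonneg v) hv
    have hv3 : 80 / lam * ζ * ‖v‖ * ‖v‖ ≤ 1 / 2 * 1 * 1 := by gcongr
    linarith
  intro δ hδ h hmin
  refine (huber_bahadur hτ hr₁0 hR0 hlt (fun i => w (x i)) (fun i => o (x i))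
    (fun i => hingeIncr α (e (x i)) ⟪w (x i), δ⟫) ?_ h₄ h hmin).trans hfin
  intro η hη u hu
  rw [hR, hk₂, hk₃]
  exact huber_linearization hτ hr₀ hr₁0 hT (by positivity) (fun i => w (x i))
    (fun i => o (x i)) (fun i => hingeIncr α (e (x i)) ⟪w (x i), δ⟫) δ η hδ hη h₁ h₂ (h₃ hgram)
    (fun i => abs_hingeIncr_le M.alpha_nonneg M.alpha_le_one _ _) (h₅ hgram δ hδ) u hu

/-! ### Square roots of the second moment matrix -/

section SqrtMul

variable {p : ℕ} {S : Matrix (Fin p) (Fin p) ℝ}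

lemma isUnit_det_sqrt (hS : S.PosDef) : IsUnit (CFC.sqrt S).det := by
  have h := CFC.sqrt_mul_sqrt_self S hS.posSemidef.nonneg
  have h2 := congrArg Matrix.det h
  rw [Matrix.det_mul] at h2
  rw [isUnit_iff_ne_zero]
  intro h0
  rw [h0, mul_zero] at h2
  exact hS.det_pos.ne h2

lemma toEuclideanLin_mul_apply (A B : Matrix (Fin p) (Fin p) ℝ) (v : Vec p) :
    Matrix.toEuclideanLin (A * B) v = Matrix.toEuclideanLin A (Matrix.toEuclideanLin B v) := by
  simp [Matrix.toLpLin_apply, Matrix.mulVec_mulVec]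

lemma sqrtMul_invSqrtMul (hS : S.PosDef) (v : Vec p) : sqrtMul S (invSqrtMul S v) = v := by
  unfold sqrtMul invSqrtMul
  rw [← toEuclideanLin_mul_apply, Matrix.mul_nonsing_inv _ (isUnit_det_sqrt hS)]
  simp

lemma sqrtMul_sqrtMul (hS : S.PosDef) (v : Vec p) :
    sqrtMul S (sqrtMul S v) = Matrix.toEuclideanLin S v := by
  unfold sqrtMul
  rw [← toEuclideanLin_mul_apply, CFC.sqrt_mul_sqrt_self S hS.posSemidef.nonneg]

lemma inner_sqrtMul (u v : Vec p) : ⟪sqrtMul S u, v⟫ = ⟪u, sqrtMul S v⟫ := by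
  have h : (CFC.sqrt S).IsHermitian := 
    (Matrix.nonneg_iff_posSemidef.1 (CFC.sqrt_nonneg S)).isHermitian
  exact (Matrix.isSymmetric_toEuclideanLin_iff.2 h) u v

lemma inner_invSqrtMul_sqrtMul (hS : S.PosDef) (x v : Vec p) :
    ⟪invSqrtMul S x, sqrtMul S v⟫ = ⟪x, v⟫ := by
  rw [← inner_sqrtMul, sqrtMul_invSqrtMul hS]

lemma inner_invSqrtMul (hS : S.PosDef) (x v : Vec p) :
    ⟪invSqrtMul S x, v⟫ = ⟪x, invSqrtMul S v⟫ := by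
  rw [← inner_invSqrtMul_sqrtMul hS x (invSqrtMul S v), sqrtMul_invSqrtMul hS]

lemma measurable_invSqrtMul (S : Matrix (Fin p) (Fin p) ℝ) : Measurable (invSqrtMul S) :=
  (LinearMap.continuous_of_finiteDimensional (Matrix.toEuclideanLin (CFC.sqrt S)⁻¹)).measurable

end SqrtMul

/-! ### From the conditional model to the standardized model -/

/-- Layer-cake bound of the squared exponential moment by a sub-Gaussian tail. -/
lemma lintegral_exp_sq_le_of_tail {Ω : Type*} [MeasurableSpace Ω] (ν : Measure Ω)
    [IsProbabilityMeasure ν] {a : Ω → ℝ} (ha : Measurable a) {υ : ℝ} (hυ : 0 < υ)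
    (htail : ∀ s : ℝ, 0 ≤ s → ν.real {x | υ * s ≤ |a x|} ≤ 2 * Real.exp (-s ^ 2 / 2)) :
    ∫⁻ x, ENNReal.ofReal (Real.exp (1 / (4 * υ ^ 2) * a x ^ 2)) ∂ν ≤ ENNReal.ofReal 3 := by
  set f : Ω → ℝ := fun x => 1 / (4 * υ ^ 2) * a x ^ 2
  have hf0 : ∀ x, 0 ≤ f x := fun x => by positivity
  have hfm : Measurable f := (ha.pow_const 2).const_mul _
  have hlc := lintegral_comp_eq_lintegral_meas_le_mul_of_measurable ν (f := f) (g := Real.exp) hf0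
    hfm (fun t _ => intervalIntegral.intervalIntegrable_exp) Real.measurable_exp
    (fun t _ => (Real.exp_pos t).le)
  simp only [integral_exp, Real.exp_zero] at hlc
  have hset : ∀ t : ℝ, 0 < t → ν {x | t ≤ f x} ≤ ENNReal.ofReal (2 * Real.exp (-(2 * t))) := by
    intro t ht
    have h1 := htail (2 * √t) (by positivity)
    have h2 : {x | υ * (2 * √t) ≤ |a x|} = {x | t ≤ f x} := by
      ext x
      simp only [mem_ofPred_eq, f]
      rw [← abs_of_pos (by positivity : 0 < υ * (2 * √t)), ← sq_le_sq, mul_pow, mul_pow,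
        Real.sq_sqrt ht.le, one_div, ← div_eq_inv_mul, le_div_iff₀ (by positivity)]
      constructor <;> intro h <;> linarith
    rw [h2, mul_pow, Real.sq_sqrt ht.le] at h1
    rw [← ofReal_measureReal (measure_ne_top _ _)]
    refine ENNReal.ofReal_le_ofReal (h1.trans (le_of_eq ?_))
    congr 2
    ring
  have hint : ∫⁻ t in Ioi (0 : ℝ), ENNReal.ofReal (2 * Real.exp (-t)) = ENNReal.ofReal 2 := by
    have hi : IntegrableOn (fun t : ℝ => 2 * Real.exp (-t)) (Ioi 0) := by
      have := (exp_neg_integrableOn_Ioi 0 (b := 1) one_pos).const_mul 2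
      simpa [IntegrableOn] using this
    rw [← ofReal_integral_eq_lintegral_ofReal hi
      (Filter.Eventually.of_forall fun t => by positivity), integral_const_mul,
      integral_exp_neg_Ioi_zero, mul_one]
  have hle : ∫⁻ x, ENNReal.ofReal (Real.exp (f x) - 1) ∂ν ≤ ENNReal.ofReal 2 := by
    rw [hlc, ← hint]
    refine setLIntegral_mono (by fun_prop) fun t ht => ?_
    refine (mul_le_mul_left (hset t ht) _).trans (le_of_eq ?_)
    rw [← ENNReal.ofReal_mul (by positivity), mul_assoc, ← Real.exp_add]
    congr 3
    ring
  calc ∫⁻ x, ENNReal.ofReal (Real.exp (f x)) ∂ν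
      = ∫⁻ x, (1 + ENNReal.ofReal (Real.exp (f x) - 1)) ∂ν := by
        refine lintegral_congr fun x => ?_
        rw [← ENNReal.ofReal_one, ← ENNReal.ofReal_add (by norm_num)
          (by linarith [Real.add_one_le_exp (f x), hf0 x])]
        congr 1
        ring
    _ = 1 + ∫⁻ x, ENNReal.ofReal (Real.exp (f x) - 1) ∂ν := by
        rw [lintegral_add_left measurable_const]
        simp
    _ ≤ 1 + ENNReal.ofReal 2 := by gcongr
    _ = ENNReal.ofReal 3 := by
        rw [← ENNReal.ofReal_one, ← ENNReal.ofReal_add (by norm_num) (by norm_num)]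
        norm_num

section Conditional

open Filter Topology

/-- A probability measure on `ℝ` with a continuous distribution function attains the level `α` exactly
at its `α`-quantile. -/
lemma measureReal_Iic_sInf_eq (κ : Measure ℝ) [IsProbabilityMeasure κ] {α : ℝ} (h0 : 0 < α)
    (h1 : α < 1) (hc : Continuous fun y => κ.real (Iic y)) :
    κ.real (Iic (sInf {y : ℝ | α ≤ κ.real (Iic y)})) = α := by
  set F : ℝ → ℝ := fun y => κ.real (Iic y) with hF
  have hFc : F = cdf κ := by
    ext y
    exact (cdf_eq_real κ y).symm
  have hmono : Monotone F := hFc ▸ monotone_cdf κ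
  set s : Set ℝ := {y : ℝ | α ≤ F y}
  have hne : s.Nonempty := by
    have h := (tendsto_cdf_atTop κ).eventually (lt_mem_nhds h1)
    rw [← hFc] at h
    obtain ⟨y, hy⟩ := h.exists
    exact ⟨y, hy.le⟩
  have hbdd : BddBelow s := by
    have h := (tendsto_cdf_atBot κ).eventually (gt_mem_nhds h0)
    rw [← hFc] at h
    obtain ⟨y, hy⟩ := h.exists
    refine ⟨y, fun x hx => ?_⟩
    by_contra hlt
    have := hmono (not_le.1 hlt).le
    exact absurd (le_trans hx this) (not_le.2 hy)
  have hmem : sInf s ∈ s := (isClosed_le continuous_const hc).csInf_mem hne hbdd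
  refine le_antisymm ?_ hmem
  by_contra hlt
  rw [not_le] at hlt
  have hev : ∀ᶠ y in 𝓝 (sInf s), α < F y := hc.continuousAt.eventually (lt_mem_nhds hlt)
  have hev2 : ∀ᶠ y in 𝓝[<] (sInf s), α < F y := hev.filter_mono nhdsWithin_le_nhds
  obtain ⟨y, hy1, hy2⟩ := (hev2.and self_mem_nhdsWithin).exists
  exact absurd (csInf_le hbdd hy1.le) (not_le.2 hy2)

/-- With `F` the distribution function of the residual `y - q` and `F(0) = α`, the mean of the hinge
increment lies between `s (F(0) - F(s))` and `0`. -/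
lemma abs_integral_hingeIncr_le (κ : Measure ℝ) [IsProbabilityMeasure κ] {α f q : ℝ}
    (h0 : 0 ≤ α) (h1 : α ≤ 1) (hα : κ.real {y | y - q ≤ 0} = α)
    (hf : ∀ s : ℝ, |κ.real {y | y - q ≤ s} - κ.real {y | y - q ≤ 0}| ≤ f * |s|) (s : ℝ) :
    |∫ y, hingeIncr α (y - q) s ∂κ| ≤ f * s ^ 2 := by
  have hm : ∀ r : ℝ, MeasurableSet {y : ℝ | y - q ≤ r} := fun r =>
    measurableSet_le (by fun_prop) measurable_const
  have hind : ∀ r : ℝ, Integrable ({y : ℝ | y - q ≤ r}.indicator fun _ => (1 : ℝ)) κ := fun r =>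
    (integrable_const _).indicator (hm r)
  have hintind : ∀ r : ℝ, ∫ y, {y : ℝ | y - q ≤ r}.indicator (fun _ => (1 : ℝ)) y ∂κ =
      κ.real {y | y - q ≤ r} := fun r => by
    rw [integral_indicator_const _ (hm r)]
    simp
  have hmeas : Measurable fun y => hingeIncr α (y - q) s := by
    unfold hingeIncr
    fun_prop
  have hint : Integrable (fun y => hingeIncr α (y - q) s) κ :=
    Integrable.of_bound hmeas.aestronglyMeasurable |s|
      (Filter.Eventually.of_forall fun y => abs_hingeIncr_le h0 h1 _ _)
  have hlo : ∫ y, (α * s - s * {y : ℝ | y - q ≤ s}.indicator (fun _ => (1 : ℝ)) y) ∂κ ≤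
      ∫ y, hingeIncr α (y - q) s ∂κ := by
    refine integral_mono ((integrable_const _).sub ((hind s).const_mul s)) hint fun y => ?_
    simp only [indicator, mem_ofPred_eq, hingeIncr]
    split_ifs with h <;> grind
  have hhi : ∫ y, hingeIncr α (y - q) s ∂κ ≤
      ∫ y, (α * s - s * {y : ℝ | y - q ≤ 0}.indicator (fun _ => (1 : ℝ)) y) ∂κ := by
    refine integral_mono hint ((integrable_const _).sub ((hind 0).const_mul s)) fun y => ?_
    simp only [indicator, mem_ofPred_eq, hingeIncr]
    split_ifs with h <;> grind
  rw [integral_sub (integrable_const _) ((hind _).const_mul s), integral_const_mul s, hintind]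
    at hlo hhi
  simp only [integral_const, probReal_univ, one_smul] at hlo hhi
  have h2 := hf s
  rw [hα] at h2 hhi
  have h3 : |s * (κ.real {y | y - q ≤ s} - α)| ≤ f * s ^ 2 := by
    rw [abs_mul, ← sq_abs s]
    nlinarith [abs_nonneg s]
  rw [abs_le] at h3 ⊢
  constructor <;> nlinarith

lemma esResid_eq {p : ℕ} (α : ℝ) (β θ x : Vec p) (y : ℝ) :
    esResid α β θ x y = min (y - ⟪x, β⟫) 0 + α * ⟪x, β - θ⟫ := by
  unfold esResid leInd
  congr 1
  by_cases h : y ≤ ⟪x, β⟫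
  · rw [indicator_of_mem (mem_Iic.2 h), mul_one, min_eq_left (by linarith)]
  · rw [indicator_of_notMem (by simpa using h), mul_zero, min_eq_right (by linarith)]

/-- Under the joint linear model the ES residual is the centered negative part of the quantile
residual; its conditional second moment is therefore at most `σ²`. -/
lemma conditional_moments {p : ℕ} (P : Measure (Vec p × ℝ)) [IsProbabilityMeasure P] {α : ℝ}
    (h0 : 0 < α) (h1 : α < 1) {β θ : Vec p} (hJ : JointModel P α β θ) {f σ : ℝ}
    (hR : ResidualCondition P β f σ) :
    ∀ᵐ x ∂P.fst,
      (∫ y, esResid α β θ x y ∂(P.condKernel x) = 0) ∧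
      (∫⁻ y, ENNReal.ofReal (esResid α β θ x y ^ 2) ∂(P.condKernel x) ≤ ENNReal.ofReal (σ ^ 2)) ∧
      (∀ s : ℝ, |∫ y, hingeIncr α (y - ⟪x, β⟫) s ∂(P.condKernel x)| ≤ f * s ^ 2) := by
  filter_upwards [hJ, hR] with x hJx hRx
  obtain ⟨hq, hqint, hES⟩ := hJx
  obtain ⟨hcd, hlip, hmem, hvar⟩ := hRx
  set κ := P.condKernel x
  have hres : ∀ s, {y : ℝ | y - ⟪x, β⟫ ≤ s} = Iic (s + ⟪x, β⟫) := by
    intro s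
    ext y
    simp only [mem_ofPred_eq, mem_Iic]
    constructor <;> intro h <;> linarith
  have hcont : Continuous fun y => κ.real (Iic y) := by
    have h2 : (fun y => κ.real (Iic y)) = fun y => residCDF P β x (y - ⟪x, β⟫) := by
      ext y
      unfold residCDF
      rw [hres, sub_add_cancel]
    rw [h2]
    exact hcd.continuous.comp (by fun_prop)
  have hFα : κ.real (Iic ⟪x, β⟫) = α := by
    have := measureReal_Iic_sInf_eq κ h0 h1 hcont
    rwa [show sInf {y : ℝ | α ≤ κ.real (Iic y)} = ⟪x, β⟫ from hq] at this
  rw [hq] at hqint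
  have hmean : ∫ y, min (y - ⟪x, β⟫) 0 ∂κ = α * ⟪x, θ⟫ - α * ⟪x, β⟫ := by
    have h2 : (fun y : ℝ => min (y - ⟪x, β⟫) 0) =
        (Iic ⟪x, β⟫).indicator fun y => y - ⟪x, β⟫ := by
      ext y
      by_cases h : y ≤ ⟪x, β⟫
      · rw [indicator_of_mem (mem_Iic.2 h), min_eq_left (by linarith)]
      · rw [indicator_of_notMem (by simpa using h), min_eq_right (by linarith)]
    rw [h2, integral_indicator measurableSet_Iic, integral_sub hqint (integrable_const _)]
    have h3 : ∫ y in Iic ⟪x, β⟫, y ∂κ = α * ⟪x, θ⟫ := by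
      unfold condES at hES
      rw [hq, setAverage_eq, hFα, smul_eq_mul, inv_mul_eq_iff_eq_mul₀ h0.ne'] at hES
      exact hES
    rw [h3, setIntegral_const, hFα, smul_eq_mul]
  have hint : Integrable (fun y : ℝ => min (y - ⟪x, β⟫) 0) κ := hmem.integrable (by norm_num)
  have ho : ∀ y, esResid α β θ x y = min (y - ⟪x, β⟫) 0 - ∫ y, min (y - ⟪x, β⟫) 0 ∂κ := by
    intro y
    rw [esResid_eq, hmean, inner_sub_right]
    ring
  refine ⟨?_, ?_, ?_⟩
  · simp only [ho]
    rw [integral_sub hint (integrable_const _)]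
    simp
  · simp only [ho]
    rw [← evariance_eq_lintegral_ofReal (fun y : ℝ => min (y - ⟪x, β⟫) 0) κ, ← ofReal_variance hmem]
    exact ENNReal.ofReal_le_ofReal hvar
  · refine abs_integral_hingeIncr_le κ h0.le h1.le ?_ hlip
    rw [hres, zero_add]
    exact hFα

end Conditional

section Model

variable {p : ℕ}

/-- The tail condition on `W = Σ^{-1/2} X` yields squared exponential moments at `1 / (4 υ²)`. -/
lemma subGaussianDesign_of_subGaussianCovariate (P : Measure (Vec p × ℝ)) [IsProbabilityMeasure P]
    {υ : ℝ} (hυ : 1 ≤ υ) (hS : SubGaussianCovariate P υ) :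
    SubGaussianDesign P (fun z => invSqrtMul (secondMoment P) z.1) (1 / (4 * υ ^ 2)) where
  measurable_w := (measurable_invSqrtMul _).comp measurable_fst
  lam_pos := by positivity
  lam_le := by
    rw [div_le_div_iff₀ (by positivity) (by norm_num)]
    nlinarith
  lintegral_exp_sq := by
    intro v hv
    have hm : ∀ u : Vec p, Measurable fun x : Vec p => ⟪invSqrtMul (secondMoment P) x, u⟫ := fun u =>
      (measurable_invSqrtMul _).inner_const
    have hunit : ∀ u : Vec p, ‖u‖ = 1 → ∫⁻ z, ENNReal.ofReal (Real.exp (1 / (4 * υ ^ 2) *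
        ⟪invSqrtMul (secondMoment P) z.1, u⟫ ^ 2)) ∂P ≤ ENNReal.ofReal 3 := by
      intro u hu
      have h := lintegral_exp_sq_le_of_tail P.fst (hm u) (by linarith : 0 < υ) (fun s hs => by
        simpa only [real_inner_comm] using hS.2 u hu s hs)
      have hmm := hm u
      have hmF : Measurable fun x : Vec p => ENNReal.ofReal (Real.exp (1 / (4 * υ ^ 2) *
        ⟪invSqrtMul (secondMoment P) x, u⟫ ^ 2)) := by fun_prop
      rwa [Measure.fst, lintegral_map hmF measurable_fst] at h
    rcases eq_or_ne v 0 with rfl | hv0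
    · simp
    have hn : 0 < ‖v‖ := norm_pos_iff.2 hv0
    refine le_trans (lintegral_mono fun z => ENNReal.ofReal_le_ofReal ?_) (hunit (‖v‖⁻¹ • v)
      (by rw [norm_smul, norm_inv, norm_norm, inv_mul_cancel₀ hn.ne']))
    rw [Real.exp_le_exp, inner_smul_right, mul_pow]
    have h1 : 1 ≤ (‖v‖⁻¹) ^ 2 := one_le_pow₀ ((one_le_inv₀ hn).2 hv)
    exact mul_le_mul_of_nonneg_left (le_mul_of_one_le_left (sq_nonneg _) h1) (by positivity)

lemma SubGaussianDesign.integrable_mul {Z : Type*} [MeasurableSpace Z] {P : Measure Z}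
    {w : Z → Vec p} {lam : ℝ} (M : SubGaussianDesign P w lam) (u v : Vec p) :
    Integrable (fun z => ⟪w z, u⟫ * ⟪w z, v⟫) P := by
  have hunit : ∀ u : Vec p, ‖‖u‖⁻¹ • u‖ ≤ 1 := fun u => by
    rw [norm_smul, norm_inv, norm_norm]
    exact inv_mul_le_one
  have h := (M.integrable_of_abs_le_exp (hunit u) (hunit v)
    (F := fun z => ⟪w z, ‖u‖⁻¹ • u⟫ * ⟪w z, ‖v‖⁻¹ • v⟫) ((M.measurable_inner _).mul
      (M.measurable_inner _)) (C := 1 / lam) (one_div_pos.2 M.lam_pos).le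
      (fun z => by rw [abs_mul]; exact M.abs_mul_abs_le_exp _ _)).1
  refine (h.const_mul (‖u‖ * ‖v‖)).congr (Filter.Eventually.of_forall fun z => ?_)
  simp only [inner_smul_right]
  rcases eq_or_ne u 0 with rfl | hu
  · simp
  rcases eq_or_ne v 0 with rfl | hv
  · simp
  have := norm_pos_iff.2 hu
  have := norm_pos_iff.2 hv
  field_simp

lemma SubGaussianDesign.integrable_sq_mul_abs_all {Z : Type*} [MeasurableSpace Z] {P : Measure Z}
    {w : Z → Vec p} {lam : ℝ} (M : SubGaussianDesign P w lam) (u v : Vec p) :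
    Integrable (fun z => ⟪w z, v⟫ ^ 2 * |⟪w z, u⟫|) P := by
  have hunit : ∀ u : Vec p, ‖‖u‖⁻¹ • u‖ ≤ 1 := fun u => by
    rw [norm_smul, norm_inv, norm_norm]
    exact inv_mul_le_one
  refine ((M.integrable_sq_mul_abs (hunit u) (hunit v)).1.const_mul (‖u‖ * ‖v‖ ^ 2)).congr
    (Filter.Eventually.of_forall fun z => ?_)
  simp only [inner_smul_right, abs_mul, abs_inv, abs_norm]
  rcases eq_or_ne u 0 with rfl | hu
  · simp
  rcases eq_or_ne v 0 with rfl | hv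
  · simp
  have := norm_pos_iff.2 hu
  have := norm_pos_iff.2 hv
  field_simp

/-- Standardization makes the covariate isotropic. -/
lemma integral_inner_invSqrtMul_mul (P : Measure (Vec p × ℝ)) [IsProbabilityMeasure P]
    {υ : ℝ} (hυ : 1 ≤ υ) (hS : SubGaussianCovariate P υ) (u v : Vec p) :
    ∫ z, ⟪invSqrtMul (secondMoment P) z.1, u⟫ * ⟪invSqrtMul (secondMoment P) z.1, v⟫ ∂P = ⟪u, v⟫ := by
  have M := subGaussianDesign_of_subGaussianCovariate P hυ hS
  set S := secondMoment P with hSdef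
  have hPD : S.PosDef := hS.1
  have hmul : ∀ a b : Vec p, Integrable (fun z : Vec p × ℝ => ⟪z.1, a⟫ * ⟪z.1, b⟫) P := by
    intro a b
    have := M.integrable_mul (sqrtMul S a) (sqrtMul S b)
    simpa only [← hSdef, inner_invSqrtMul_sqrtMul hPD] using this
  have hentry : ∀ i j, ∫ z : Vec p × ℝ, z.1 i * z.1 j ∂P = S i j := by
    intro i j
    have h : ∫ x : Vec p, x i * x j ∂P.fst = ∫ z : Vec p × ℝ, z.1 i * z.1 j ∂P := by
      rw [Measure.fst, integral_map measurable_fst.aemeasurable]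
      exact (by fun_prop : Measurable fun x : Vec p => x i * x j).aestronglyMeasurable
    rw [← h, hSdef]
    rfl
  have hentryint : ∀ i j, Integrable (fun z : Vec p × ℝ => z.1 i * z.1 j) P := by
    intro i j
    have := hmul (EuclideanSpace.single i 1) (EuclideanSpace.single j 1)
    simpa [EuclideanSpace.inner_single_right] using this
  have hcov : ∀ a b : Vec p, ∫ z : Vec p × ℝ, ⟪z.1, a⟫ * ⟪z.1, b⟫ ∂P =
      ⟪a, Matrix.toEuclideanLin S b⟫ := by
    intro a b
    have h1 : ∀ z : Vec p × ℝ, ⟪z.1, a⟫ * ⟪z.1, b⟫ =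
        ∑ i, ∑ j, a i * b j * (z.1 i * z.1 j) := by
      intro z
      rw [PiLp.inner_apply, PiLp.inner_apply, Finset.sum_mul_sum]
      refine Finset.sum_congr rfl fun i _ => Finset.sum_congr rfl fun j _ => ?_
      simp
      ring
    simp only [h1]
    rw [integral_finsetSum _ fun i _ => integrable_finsetSum _ fun j _ =>
      (hentryint i j).const_mul _]
    rw [PiLp.inner_apply]
    refine Finset.sum_congr rfl fun i _ => ?_
    rw [integral_finsetSum _ fun j _ => (hentryint i j).const_mul _]
    simp only [integral_const_mul, hentry]
    simp only [Matrix.toLpLin_apply, Matrix.mulVec, dotProduct, RCLike.inner_apply, conj_trivial,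
      Finset.sum_mul]
    refine Finset.sum_congr rfl fun j _ => ?_
    ring
  simp only [inner_invSqrtMul hPD]
  rw [hcov, ← sqrtMul_sqrtMul hPD, sqrtMul_invSqrtMul hPD, ← inner_sqrtMul, sqrtMul_invSqrtMul hPD]

theorem standardizedModel_of_jointModel (P : Measure (Vec p × ℝ)) [IsProbabilityMeasure P]
    {α : ℝ} (h0 : 0 < α) (h1 : α < 1) {β θ : Vec p} (hJ : JointModel P α β θ) {f σ υ : ℝ}
    (hσ : 0 < σ) (hR : ResidualCondition P β f σ) (hυ : 1 ≤ υ) (hS : SubGaussianCovariate P υ) :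
    StandardizedModel P (fun z => invSqrtMul (secondMoment P) z.1) (fun z => z.2 - ⟪z.1, β⟫)
      (fun z => esResid α β θ z.1 z.2) α (1 / (4 * υ ^ 2)) f σ := by
  have M := subGaussianDesign_of_subGaussianCovariate P hυ hS
  have hcond := conditional_moments P h0 h1 hJ hR
  have hmo : Measurable fun z : Vec p × ℝ => esResid α β θ z.1 z.2 := by
    simp only [esResid_eq]
    fun_prop
  have hme : Measurable fun z : Vec p × ℝ => z.2 - ⟪z.1, β⟫ := by fun_prop
  have hmw : Measurable fun x : Vec p => invSqrtMul (secondMoment P) x := measurable_invSqrtMul _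
  have hmwi : ∀ u : Vec p, Measurable fun x : Vec p => ⟪invSqrtMul (secondMoment P) x, u⟫ := fun u =>
    hmw.inner_const
  refine { toSubGaussianDesign := M, measurable_e := hme, measurable_o := hmo,
           alpha_nonneg := h0.le, alpha_le_one := h1.le, f_nonneg := ?_, σ_pos := hσ,
           integral_inner_mul_inner := integral_inner_invSqrtMul_mul P hυ hS,
           lintegral_mul_sq_le := ?_, integral_mul_inner := ?_, integral_hingeIncr_le := ?_ }
  · obtain ⟨x, hx⟩ := hR.exists
    have h2 := (abs_nonneg _).trans (hx.2.1 1)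
    simpa using h2
  · intro h hm hnn
    have hmF : Measurable fun z : Vec p × ℝ =>
        ENNReal.ofReal (h (invSqrtMul (secondMoment P) z.1) * esResid α β θ z.1 z.2 ^ 2) :=
      (((hm.comp (hmw.comp measurable_fst))).mul (hmo.pow_const 2)).ennreal_ofReal
    have hmh : Measurable fun x : Vec p => ENNReal.ofReal (h (invSqrtMul (secondMoment P) x)) :=
      (hm.comp hmw).ennreal_ofReal
    rw [← Measure.lintegral_condKernel hmF]
    calc _ ≤ ∫⁻ x, ENNReal.ofReal (h (invSqrtMul (secondMoment P) x)) * ENNReal.ofReal (σ ^ 2)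
            ∂P.fst := by
          refine lintegral_mono_ae ?_
          filter_upwards [hcond] with x hx
          simp only [ENNReal.ofReal_mul (hnn _)]
          rw [lintegral_const_mul' _ _ ENNReal.ofReal_ne_top]
          gcongr
          exact hx.2.1
      _ = _ := by
          rw [lintegral_mul_const _ hmh, mul_comm, Measure.fst, lintegral_map hmh measurable_fst]
  · intro u
    by_cases hi : Integrable
      (fun z : Vec p × ℝ => esResid α β θ z.1 z.2 * ⟪invSqrtMul (secondMoment P) z.1, u⟫) P
    · rw [← Measure.integral_condKernel hi]
      refine integral_eq_zero_of_ae ?_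
      filter_upwards [hcond] with x hx
      simp only [integral_mul_const, hx.1, zero_mul, Pi.zero_apply]
    · exact integral_undef hi
  · intro δ u
    have hmF : Measurable fun z : Vec p × ℝ =>
        hingeIncr α (z.2 - ⟪z.1, β⟫) ⟪invSqrtMul (secondMoment P) z.1, δ⟫ *
          ⟪invSqrtMul (secondMoment P) z.1, u⟫ := by
      have h2 : Measurable fun z : Vec p × ℝ => ⟪invSqrtMul (secondMoment P) z.1, δ⟫ :=
        (hmwi δ).comp measurable_fst
      have h3 : Measurable fun z : Vec p × ℝ => ⟪invSqrtMul (secondMoment P) z.1, u⟫ :=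
        (hmwi u).comp measurable_fst
      unfold hingeIncr
      fun_prop
    have hi : Integrable (fun z : Vec p × ℝ =>
        hingeIncr α (z.2 - ⟪z.1, β⟫) ⟪invSqrtMul (secondMoment P) z.1, δ⟫ *
          ⟪invSqrtMul (secondMoment P) z.1, u⟫) P := by
      refine (M.integrable_mul δ u).mono hmF.aestronglyMeasurable
        (Filter.Eventually.of_forall fun z => ?_)
      rw [norm_mul, norm_mul]
      gcongr
      exact abs_hingeIncr_le h0.le h1.le _ _
    have h3i := M.integrable_sq_mul_abs_all u δ
    have hm3 : Measurable fun x : Vec p => ⟪invSqrtMul (secondMoment P) x, δ⟫ ^ 2 *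
        |⟪invSqrtMul (secondMoment P) x, u⟫| := ((hmwi δ).pow_const 2).mul (hmwi u).abs
    have h3map : Integrable (fun x : Vec p => ⟪invSqrtMul (secondMoment P) x, δ⟫ ^ 2 *
        |⟪invSqrtMul (secondMoment P) x, u⟫|) P.fst := by
      rw [Measure.fst, integrable_map_measure hm3.aestronglyMeasurable measurable_fst.aemeasurable]
      exact h3i
    have h3eq : ∫ z, ⟪invSqrtMul (secondMoment P) z.1, δ⟫ ^ 2 *
        |⟪invSqrtMul (secondMoment P) z.1, u⟫| ∂P = ∫ x, ⟪invSqrtMul (secondMoment P) x, δ⟫ ^ 2 *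
        |⟪invSqrtMul (secondMoment P) x, u⟫| ∂P.fst := by
      rw [Measure.fst, integral_map measurable_fst.aemeasurable hm3.aestronglyMeasurable]
    rw [h3eq, ← integral_const_mul, ← Measure.integral_condKernel hi]
    refine integral_mono_ae hi.integral_condKernel (h3map.const_mul f) ?_
    filter_upwards [hcond] with x hx
    simp only [integral_mul_const]
    refine (le_abs_self _).trans ?_
    rw [abs_mul, ← mul_assoc]
    exact mul_le_mul_of_nonneg_right (hx.2.2 _) (abs_nonneg _)

end Model

/-! ### Transfer to the sample -/

/-- In standardized coordinates the orthogonal score is linear in `α Σ^{1/2}(θ - θ*)`, and the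
first-stage fit enters only through `hingeIncr`. -/
lemma orthScore_eq {p : ℕ} {S : Matrix (Fin p) (Fin p) ℝ} (hS : S.PosDef) (α : ℝ)
    (β βs θ θs x : Vec p) (y : ℝ) :
    orthScore α β θ x y = ⟪invSqrtMul S x, α • sqrtMul S (θ - θs)⟫ -
      (esResid α βs θs x y +
        hingeIncr α (y - ⟪x, βs⟫) ⟪invSqrtMul S x, sqrtMul S (β - βs)⟫) := by
  have h : esResid α β θs x y = esResid α βs θs x y +
      hingeIncr α (y - ⟪x, βs⟫) ⟪invSqrtMul S x, sqrtMul S (β - βs)⟫ := by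
    rw [inner_invSqrtMul_sqrtMul hS, esResid_eq, esResid_eq]
    unfold hingeIncr
    simp only [inner_sub_right]
    rw [show y - ⟪x, βs⟫ - (⟪x, β⟫ - ⟪x, βs⟫) = y - ⟪x, β⟫ by ring]
    ring
  rw [← h, inner_smul_right, inner_invSqrtMul_sqrtMul hS]
  unfold orthScore esResid
  simp only [inner_sub_right]
  ring

theorem theorem4p5 :
    -- The implied constants `C` and `C₀` depend only on `υ` (the sub-Gaussian parameter) and on the
    -- constants `a`, `b`, `c₁`, `c₂` implied in the assumptions on `r₀` and `τ`.
    ∀ υ a b c₁ c₂ : ℝ, 1 ≤ υ → 0 < a → 0 < b → 0 < c₁ → 0 < c₂ →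
    ∃ C C₀ : ℝ, 0 < C ∧ 0 < C₀ ∧
    ∀ (n p : ℕ) (_ : 0 < p)
      (P : Measure (Vec p × ℝ)) [IsProbabilityMeasure P]
      (α : ℝ) (_ : 0 < α) (_ : α ≤ 1 / 2)
      (βs θs : Vec p) (_ : JointModel P α βs θs)
      (fbar σbar : ℝ) (_ : 0 < σbar) (_ : ResidualCondition P βs fbar σbar)
      (_ : SubGaussianCovariate P υ)
      -- an i.i.d. sample of size `n` from `P`
      (Ω : Type*) [MeasurableSpace Ω] (μ : Measure Ω) [IsProbabilityMeasure μ]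
      (X : Fin n → Ω → Vec p) (Y : Fin n → Ω → ℝ)
      (_ : ∀ i, HasLaw (fun ω => (X i ω, Y i ω)) P μ)
      (_ : iIndepFun (fun i ω => (X i ω, Y i ω)) μ)
      (t : ℝ) (_ : 0 < t)
      (r₀ : ℝ) (_ : 0 < r₀) (_ : r₀ ≤ a * σbar)
      (_ : fbar * r₀ ^ 2 ≤ b * (σbar * √((p + t) / n)))
      (τ : ℝ) (_ : c₁ * (σbar * √(n / (p + t))) ≤ τ) (_ : τ ≤ c₂ * (σbar * √(n / (p + t))))
      (_ : C₀ * (p + t) ≤ n),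
    ∃ E : Set Ω, MeasurableSet E ∧ 1 - 6 * Real.exp (-t) ≤ μ.real E ∧
      -- on `E ∩ {‖βhat - β*‖_Σ ≤ r₀}` the representation holds
      ∀ ω ∈ E, ∀ βhat θhat : Vec p,
        IsQREstimator α (fun i => X i ω) (fun i => Y i ω) βhat →
        IsRobustES α τ (fun i => X i ω) (fun i => Y i ω) βhat θhat →
        matNorm (secondMoment P) (βhat - βs) ≤ r₀ →
        bahadurRemainder (secondMoment P) α τ βs θs (fun i => X i ω) (fun i => Y i ω) θhat ≤
          C * (σbar * ((p + t) / n) + fbar * r₀ ^ 2 +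
            r₀ * √((p * Real.log n + t) / n)) := by
  intro υ a b c₁ c₂ hυ ha hb hc₁ hc₂
  obtain ⟨C, C₀, hC, hC₀, hmain⟩ := standardized_bahadur (lam := 1 / (4 * υ ^ 2))
    (by positivity) ha hb hc₁ hc₂
  refine ⟨C, C₀, hC, hC₀, ?_⟩
  intro n p hp P _ α hα hα2 βs θs hJ fbar σbar hσ hR hS Ω _ μ _ X Y hlaw hind t ht r₀ hr₀ hr₀a hfb
    τ hτ1 hτ2 hn
  have hPD : (secondMoment P).PosDef := hS.1
  have M := standardizedModel_of_jointModel P hα (by linarith) hJ hσ hR hυ hS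
  have hbad := hmain n p hp (Vec p × ℝ) inferInstance P inferInstance _ _ _ α fbar σbar M t ht r₀ hr₀
    hr₀a hfb τ hτ1 hτ2 hn
  set bad : Set (Fin n → Vec p × ℝ) := {x | ¬ ∀ δ : Vec p, ‖δ‖ ≤ r₀ → ∀ h : Vec p, _}
  -- The sample is distributed as the product measure, which transfers the bound on the bad set.
  have hmap : μ.map (fun ω i => (X i ω, Y i ω)) = Measure.pi fun _ => P := by
    rw [(iIndepFun_iff_map_fun_eq_pi_map fun i => (hlaw i).aemeasurable).1 hind]
    congr 1
    ext1 i
    exact (hlaw i).map_eq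
  have haem : AEMeasurable (fun ω i => (X i ω, Y i ω)) μ :=
    aemeasurable_pi_lambda _ fun i => (hlaw i).aemeasurable
  set B : Set Ω := (fun ω i => (X i ω, Y i ω)) ⁻¹' bad
  have hB : μ B ≤ 5 * ENNReal.ofReal (Real.exp (-t)) := by
    refine (Measure.le_map_apply haem bad).trans ?_
    rw [hmap]
    exact hbad
  refine ⟨(toMeasurable μ B)ᶜ, (measurableSet_toMeasurable μ B).compl, ?_, ?_⟩
  · rw [probReal_compl_eq_one_sub (measurableSet_toMeasurable μ B)]
    have h1 : μ.real (toMeasurable μ B) ≤ 5 * Real.exp (-t) := by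
      rw [measureReal_def, measure_toMeasurable]
      refine ENNReal.toReal_le_of_le_ofReal (by positivity) (hB.trans (le_of_eq ?_))
      rw [ENNReal.ofReal_mul (by norm_num)]
      simp
    linarith [Real.exp_pos (-t)]
  · intro ω hω βhat θhat _ hES hβ
    have hgood : ω ∉ B := fun h => hω (subset_toMeasurable μ B h)
    have hg := not_not.1 hgood (sqrtMul (secondMoment P) (βhat - βs)) hβ
      (α • sqrtMul (secondMoment P) (θhat - θs))
    refine hg fun η => ?_
    -- Every `η` is `α Σ^{1/2}(θ - θ*)` for some `θ`.
    set θ : Vec p := θs + α⁻¹ • invSqrtMul (secondMoment P) η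
    have hη : α • sqrtMul (secondMoment P) (θ - θs) = η := by
      have h1 : θ - θs = invSqrtMul (secondMoment P) (α⁻¹ • η) := by
        simp [θ, invSqrtMul]
      rw [h1, sqrtMul_invSqrtMul hPD, smul_smul, mul_inv_cancel₀ hα.ne', one_smul]
    have hn0 : 0 < n := by
      have hp1 : (0 : ℝ) < p := by exact_mod_cast hp
      have : (0 : ℝ) < n := lt_of_lt_of_le (by positivity) hn
      exact_mod_cast this
    have h1 := hES (mem_univ θ)
    simp only [mem_ofPred_eq, orthScore_eq hPD α βhat βs _ θs] at h1
    rw [hη] at h1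
    exact le_of_mul_le_mul_left h1 (by positivity)
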